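/- **Setting.** Let $M\ge 1$ be the maximum number of HARQ rounds, and let $R_0>0$ and $R_s<R_0$ be rates. Let $\rho_1,\dots,\rho_M>0$, $\alpha>0$, $\mu>0$. For each receiver $\beta\in\{B,E\}$ (Bob, Eve) let $\phi_\beta,S_\beta,\hat h_{f,\beta}>0$ and $h_{\beta,l}\neq 0$ be real constants. Let the magnitudes $|h_{\beta,pf,m}|$ ($\beta\in\{B,E\}$, $1\le m\le M$) of the complex fading coefficients be mutually independent random variables with density on $(0,\infty)$ $$f_\beta(x)=\frac{\phi_\beta\,\mu^{\phi_\beta/\alpha}x^{\phi_\beta-1}}{S_\beta^{\phi_\beta}\hat h_{f,\beta}^{\phi_\beta}\Gamma(\mu)}\,\Gamma\!\left(\frac{\alpha\mu-\phi_\beta}{\alpha},\frac{\mu x^\alpha}{S_\beta^\alpha\hat h_{f,\beta}^\alpha}\right),\qquad \Gamma(a,x)=\int_x^\infty u^{a-1}e^{-u}\,du .$$ The accumulated mutual information is $I_\beta(m)=\sum_{k=1}^m\log_2\!\big(1+\rho_k|h_{\beta,l}|^2|h_{\beta,pf,k}|^2\big)$, with $I_\beta(0)=0$. The number of rounds $\mathcal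 M$ is the least $m\ge1$ such that $I_B(m)\ge R_0$ or $m=M$. The connection and secrecy outage probabilities are $$P_{co}=\Pr\{I_B(M)<R_0\},\qquad P_{so}=\Pr\{I_E(\mathcal M)>R_0-R_s\}.$$ **Closed form.** Fix any $c<0$. Put $\Psi_\beta^0=1$. For $x>0$ and integer $\mu$ put $$\Psi_\beta^1(x)=1-\frac{\phi_\beta\mu^{\phi_\beta/\alpha}(2^x-1)^{\phi_\beta/2}}{\alpha S_\beta^{\phi_\beta}|h_{\beta,l}|^{\phi_\beta}\hat h_{f,\beta}^{\phi_\beta}\rho_1^{\phi_\beta/2}}\sum_{n=0}^{\mu-1}\frac1{n!}\,\Gamma\!\left(\frac{\alpha n-\phi_\beta}{\alpha},\frac{\mu(2^x-1)^{\alpha/2}}{S_\beta^\alpha|h_{\beta,l}|^\alpha\hat h_{f,\beta}^\alpha\rho_1^{\alpha/2}}\right).$$ For $m\ge2$ (and any real $\mu>0$) put $$\Psi_\beta^m(x)=\left(\frac{\phi_\beta}{2\Gamma(\mu)}\right)^{m}\frac1{2\pi \mathrm i}\int_{c-\mathrm i\infty}^{c+\mathrm i\infty}\frac{e^{-xt\ln2}}{-t}\prod_{k=1}^m\frac1{\Gamma(-t)}H^{1,3}_{3,2}\!\left[(\rho_k|h_{\beta,l}|^2)^{\frac12}\Big(\frac{\mu}{\hat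 h_{f,\beta}^\alpha S_\beta^\alpha}\Big)^{-\frac1\alpha}\,\middle|\,{(1+t,\frac12),(1-\mu,\frac1\alpha),(1-\phi_\beta,1)\atop(0,\frac12),(-\phi_\beta,1)}\right]dt .$$ Here $$H^{m,n}_{p,q}\!\left[z\,\middle|\,{(a_i,A_i)_{i\le p}\atop (b_j,B_j)_{j\le q}}\right]=\frac1{2\pi \mathrm i}\int_{\gamma-\mathrm i\infty}^{\gamma+\mathrm i\infty}\frac{\prod_{j\le m}\Gamma(b_j+B_js)\prod_{i\le n}\Gamma(1-a_i-A_is)}{\prod_{i>n}\Gamma(a_i+A_is)\prod_{j>m}\Gamma(1-b_j-B_js)}\,z^{-s}\,ds$$ is Fox's $H$ function, the line $\operatorname{Re}s=\gamma$ separating the poles of the factors $\Gamma(b_j+B_js)$, $j\le m$, from those of the factors $\Gamma(1-a_i-A_is)$, $i\le n$. **Claim.** 1. For $\beta\in\{B,E\}$, $1\le m\le M$ and $x>0$: $\Pr\{I_\beta(m)<x\}=\Psi_\beta^m(x)$, where $\mu$ is assumed to be an integer if $m=1$. In particular $P_{co}=\Psi_B^M(R_0)$ (with $\mu$ an integer if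 $M=1$). 2. The pmf of $\mathcal M$ is as follows. If $M\ge2$, then $\Pr\{\mathcal M=1\}=1-\Pr\{I_B(1)<R_0\}$. For $2\le m\le M-1$, $\Pr\{\mathcal M=m\}=\Pr\{I_B(m-1)<R_0\}-\Pr\{I_B(m)<R_0\}$. Finally, $\Pr\{\mathcal M=M\}=\Pr\{I_B(M-1)<R_0\}$. 3. $P_{so}=\sum_{m=1}^M\Pr\{\mathcal M=m\}\Pr\{I_E(m)>R_0-R_s\}$, and consequently $$P_{so}=\sum_{m=1}^{M-1}\big(\Pr\{I_B(m-1)<R_0\}-\Pr\{I_B(m)<R_0\}\big)\big(1-\Pr\{I_E(m)<R_0-R_s\}\big)+\Pr\{I_B(M-1)<R_0\}\big(1-\Pr\{I_E(M)<R_0-R_s\}\big).$$ 4. If $\mu$ is an integer, then $$P_{so}=\sum_{m=1}^{M-1}\big(\Psi_B^{m-1}(R_0)-\Psi_B^m(R_0)\big)\big(1-\Psi_E^m(R_0-R_s)\big)+\Psi_B^{M-1}(R_0)\big(1-\Psi_E^M(R_0-R_s)\big).$$ -/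

import Mathlib

open MeasureTheory ProbabilityTheory

/-! ### Special functions -/

/-- The upper incomplete Gamma function `Γ(a, x) = ∫_x^∞ u^(a-1) e^(-u) du`. -/
noncomputable def upperGamma (a x : ℝ) : ℝ :=
  ∫ u in Set.Ioi x, u ^ (a - 1) * Real.exp (-u)

/-- The Mellin--Barnes kernel of the Fox function `H^{m,n}_{p,q}`, where `a` is the list of the
`p` upper pairs `(a_i, A_i)` and `b` the list of the `q` lower pairs `(b_j, B_j)`:
`∏_{j≤m} Γ(b_j+B_j s) ∏_{i≤n} Γ(1-a_i-A_i s) / (∏_{i>n} Γ(a_i+A_i s) ∏_{j>m} Γ(1-b_j-B_j s))`. -/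
noncomputable def foxKernel (m n : ℕ) (a b : List (ℂ × ℝ)) (s : ℂ) : ℂ :=
  (((b.take m).map fun q => Complex.Gamma (q.1 + q.2 * s)).prod *
      ((a.take n).map fun q => Complex.Gamma (1 - q.1 - q.2 * s)).prod) /
    (((a.drop n).map fun q => Complex.Gamma (q.1 + q.2 * s)).prod *
      ((b.drop m).map fun q => Complex.Gamma (1 - q.1 - q.2 * s)).prod)

/-- The line `Re s = γ` separates the poles of the factors `Γ(b_j + B_j s)`, `j ≤ m` (which
extend to the left) from those of the factors `Γ(1 - a_i - A_i s)`, `i ≤ n` (which extend to the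
right): for positive `A_i`, `B_j` this says that the arguments have positive real part on it. -/
def FoxSeparates (m n : ℕ) (a b : List (ℂ × ℝ)) (γ : ℝ) : Prop :=
  (∀ q ∈ b.take m, 0 < q.1.re + q.2 * γ) ∧ (∀ q ∈ a.take n, 0 < 1 - q.1.re - q.2 * γ)

open Classical in
/-- The Fox function `H^{m,n}_{p,q}[z | a; b] = (1/(2πi)) ∫_{γ-i∞}^{γ+i∞} kernel(s) z^(-s) ds`
at `z > 0`, along a vertical line that separates the two families of poles.
`mellinInv γ f z` is Mathlib's name for `(1/(2πi)) ∫_{γ-i∞}^{γ+i∞} f(s) z^(-s) ds`.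
(The default value `0` is used only if no vertical line separates the poles.) -/
noncomputable def foxH (m n : ℕ) (a b : List (ℂ × ℝ)) (z : ℝ) : ℂ :=
  if h : ∃ γ : ℝ, FoxSeparates m n a b γ then
    mellinInv h.choose (foxKernel m n a b) z
  else 0

/-! ### The fading law and the closed form `Ψ` -/

/-- The density on `(0, ∞)` of the magnitude of the combined misalignment and multipath
fading coefficient. -/
noncomputable def fadingPDF (α μ φ S hf : ℝ) (x : ℝ) : ℝ :=
  φ * μ ^ (φ / α) * x ^ (φ - 1) / (S ^ φ * hf ^ φ * Real.Gamma μ) *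
    upperGamma ((α * μ - φ) / α) (μ * x ^ α / (S ^ α * hf ^ α))

/-- The closed form for one HARQ round (meant for integer `μ`, so that the sum runs over
`n = 0, …, μ - 1`). -/
noncomputable def psiOne (α μ φ S hf hl ρ₁ : ℝ) (x : ℝ) : ℝ :=
  1 - φ * μ ^ (φ / α) * ((2 : ℝ) ^ x - 1) ^ (φ / 2) /
      (α * S ^ φ * |hl| ^ φ * hf ^ φ * ρ₁ ^ (φ / 2)) *
    ∑ n ∈ Finset.range ⌊μ⌋₊, 1 / (n.factorial : ℝ) *
      upperGamma ((α * n - φ) / α)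
        (μ * ((2 : ℝ) ^ x - 1) ^ (α / 2) / (S ^ α * |hl| ^ α * hf ^ α * ρ₁ ^ (α / 2)))

/-- The `k`-th factor
`(1/Γ(-t)) H^{1,3}_{3,2}[z | (1+t,1/2), (1-μ,1/α), (1-φ,1); (0,1/2), (-φ,1)]` with
`z = (ρ |hl|²)^(1/2) (μ / (hf^α S^α))^(-1/α)`. -/
noncomputable def psiFactor (α μ φ S hf hl ρ : ℝ) (t : ℂ) : ℂ :=
  1 / Complex.Gamma (-t) *
    foxH 1 3
      [(1 + t, 1 / 2), (1 - (μ : ℂ), 1 / α), (1 - (φ : ℂ), 1)]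
      [(0, 1 / 2), (-(φ : ℂ), 1)]
      ((ρ * |hl| ^ 2) ^ (1 / 2 : ℝ) * (μ / (hf ^ α * S ^ α)) ^ (-(1 / α)))

/-- The inverse Laplace transform
`(φ/(2Γ(μ)))^m (1/(2πi)) ∫_{c-i∞}^{c+i∞} e^(-x t ln 2)/(-t) ∏_{k=1}^m psiFactor ρ_k t dt`,
with `t = c + iv`, `dt = i dv`. -/
noncomputable def psiContour (α μ φ S hf hl : ℝ) (ρ : ℕ → ℝ) (c : ℝ) (m : ℕ) (x : ℝ) : ℂ :=
  ((φ / (2 * Real.Gamma μ) : ℝ) : ℂ) ^ m * (1 / (2 * Real.pi * Complex.I)) *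
    ∫ v : ℝ, (fun t : ℂ => Complex.exp (-x * t * Real.log 2) / (-t) *
        ∏ k ∈ Finset.Icc 1 m, psiFactor α μ φ S hf hl (ρ k) t) (c + v * Complex.I) * Complex.I

/-- The closed form `Ψ^m(x)`, with the convention `Ψ^0 = 1`. -/
noncomputable def psi (α μ φ S hf hl : ℝ) (ρ : ℕ → ℝ) (c : ℝ) : ℕ → ℝ → ℂ
  | 0, _ => 1
  | 1, x => (psiOne α μ φ S hf hl (ρ 1) x : ℂ)
  | m + 2, x => psiContour α μ φ S hf hl ρ c (m + 2) x

/-! ### The transmission scheme -/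

/-- The two receivers: the legitimate user Bob and the eavesdropper Eve. -/
inductive Receiver
  | bob
  | eve

/-- Mutual information accumulated in rounds `1, …, m` at a receiver with path gain `hl` and
fading coefficients `h k`, `k ≥ 1`. -/
noncomputable def mutualInfo {Ω : Type*} (ρ : ℕ → ℝ) (hl : ℝ) (h : ℕ → Ω → ℂ) (m : ℕ) (ω : Ω) : ℝ :=
  ∑ k ∈ Finset.Icc 1 m, Real.logb 2 (1 + ρ k * |hl| ^ 2 * ‖h k ω‖ ^ 2)

/-- Number of HARQ rounds used: the first round `m ≥ 1` after which Bob has accumulated at least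
`R₀` (no outage any more) or the maximum number `M` of rounds is reached. -/
noncomputable def numRounds {Ω : Type*} (M : ℕ) (R₀ : ℝ) (IB : ℕ → Ω → ℝ) (ω : Ω) : ℕ :=
  sInf {m : ℕ | 1 ≤ m ∧ (R₀ ≤ IB m ω ∨ m = M)}

/-- Connection outage probability `P{I_B(M) < R₀}`. -/
noncomputable def connectionOutage {Ω : Type*} [MeasurableSpace Ω] (P : Measure Ω)
    (M : ℕ) (R₀ : ℝ) (IB : ℕ → Ω → ℝ) : ℝ :=
  P.real {ω | IB M ω < R₀}

/-- Secrecy outage probability: by the end of the HARQ cycle, Eve has accumulated more than the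
dummy message rate `R₀ - Rs`. -/
noncomputable def secrecyOutage {Ω : Type*} [MeasurableSpace Ω] (P : Measure Ω)
    (M : ℕ) (R₀ Rs : ℝ) (IB IE : ℕ → Ω → ℝ) : ℝ :=
  P.real {ω | R₀ - Rs < IE (numRounds M R₀ IB ω) ω}

/-! ### Mellin transforms -/

/-- The Mellin transform turns a multiplicative convolution into a product. -/
theorem hasMellin_integral_comp_mul {Ω : Type*} [MeasurableSpace Ω] {ν : Measure Ω} [SFinite ν]
    {k : ℝ → ℂ} {s m : ℂ} (hk : Measurable k) (hkm : HasMellin k s m) {w : Ω → ℂ} {W : Ω → ℝ}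
    (hw : AEStronglyMeasurable w ν) (hW : Measurable W) (hpos : ∀ᵐ ω ∂ν, 0 < W ω)
    (hint : Integrable (fun ω => w ω * (W ω : ℂ) ^ (-s)) ν) :
    HasMellin (fun z : ℝ => ∫ ω, w ω * k (z * W ω) ∂ν) s
      ((∫ ω, w ω * (W ω : ℂ) ^ (-s) ∂ν) * m) := by
  set G : ℝ → Ω → ℂ := fun z ω => (z : ℂ) ^ (s - 1) * (w ω * k (z * W ω)) with hG
  have hGm : AEStronglyMeasurable (Function.uncurry G)
      ((volume.restrict (Set.Ioi (0 : ℝ))).prod ν) := by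
    refine AEStronglyMeasurable.mul ?_ (AEStronglyMeasurable.mul ?_ ?_)
    · exact (by fun_prop : Measurable fun p : ℝ × Ω => ((p.1 : ℂ)) ^ (s - 1)).aestronglyMeasurable
    · exact hw.comp_snd
    · exact (hk.comp (measurable_fst.mul (hW.comp measurable_snd))).aestronglyMeasurable
  have hsec : ∀ ω, 0 < W ω → IntegrableOn (fun z => G z ω) (Set.Ioi 0) ∧
      ∫ z in Set.Ioi (0 : ℝ), G z ω = w ω * (W ω : ℂ) ^ (-s) * m := by
    intro ω hω
    have e : (fun z => G z ω) = fun z : ℝ => w ω * ((z : ℂ) ^ (s - 1) • k (W ω * z)) := by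
      funext z
      simp only [hG, smul_eq_mul, mul_comm z (W ω)]
      ring
    constructor
    · rw [e]
      exact ((MellinConvergent.comp_mul_left hω).2 hkm.1).const_mul _
    · have := mellin_comp_mul_left k s hω
      rw [mellin, hkm.2] at this
      rw [e, integral_const_mul, this, smul_eq_mul]
      ring
  have hnorm : ∀ ω, 0 < W ω → ∫ z in Set.Ioi (0 : ℝ), ‖G z ω‖ =
      ‖w ω * (W ω : ℂ) ^ (-s)‖ * ∫ z in Set.Ioi (0 : ℝ), ‖(z : ℂ) ^ (s - 1) • k z‖ := by
    intro ω hω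
    have e : ∀ z ∈ Set.Ioi (0 : ℝ), ‖G z ω‖ = (‖w ω‖ * W ω ^ (1 - s.re)) *
        (fun y : ℝ => ‖(y : ℂ) ^ (s - 1) • k y‖) (W ω * z) := by
      intro z hz
      have hz : 0 < z := hz
      simp only [hG, norm_smul, norm_mul, mul_comm z (W ω),
        Complex.norm_cpow_eq_rpow_re_of_pos hz,
        Complex.norm_cpow_eq_rpow_re_of_pos (mul_pos hω hz)]
      rw [Real.mul_rpow hω.le hz.le]
      have : W ω ^ (1 - s.re) * W ω ^ (s - 1).re = 1 := by
        rw [← Real.rpow_add hω]; simp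
      linear_combination (-(z ^ (s - 1).re * (‖w ω‖ * ‖k (W ω * z)‖))) * this
    rw [setIntegral_congr_fun measurableSet_Ioi e, integral_const_mul,
      integral_comp_mul_left_Ioi (fun y : ℝ => ‖(y : ℂ) ^ (s - 1) • k y‖) 0 hω, mul_zero, norm_mul,
      Complex.norm_cpow_eq_rpow_re_of_pos hω, smul_eq_mul, sub_eq_add_neg, Real.rpow_add hω,
      Real.rpow_one, Complex.neg_re]
    field_simp
  have hGi : Integrable (Function.uncurry G) ((volume.restrict (Set.Ioi (0 : ℝ))).prod ν) := by
    rw [integrable_prod_iff' hGm]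
    refine ⟨hpos.mono fun ω hω => (hsec ω hω).1, ?_⟩
    refine (hint.norm.mul_const (∫ z in Set.Ioi (0 : ℝ), ‖(z : ℂ) ^ (s - 1) • k z‖)).congr ?_
    exact hpos.mono fun ω hω => (hnorm ω hω).symm
  have hz : ∀ z : ℝ, (z : ℂ) ^ (s - 1) • ∫ ω, w ω * k (z * W ω) ∂ν = ∫ ω, G z ω ∂ν := by
    intro z
    rw [smul_eq_mul, ← integral_const_mul]
  constructor
  · have := hGi.integral_prod_left
    rw [MellinConvergent]
    simp_rw [hz]
    exact this
  · rw [mellin]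
    simp_rw [hz]
    rw [integral_integral_swap hGi, ← integral_mul_const]
    exact integral_congr_ae (hpos.mono fun ω hω => (hsec ω hω).2)

theorem hasMellin_cexp_neg {s : ℂ} (hs : 0 < s.re) :
    HasMellin (fun x : ℝ => Complex.exp (-x)) s (Complex.Gamma s) := by
  constructor
  · refine (Complex.GammaIntegral_convergent hs).congr_fun (fun x _ => ?_) measurableSet_Ioi
    simp [mul_comm]
  · rw [Complex.Gamma_eq_integral hs, Complex.GammaIntegral_eq_mellin]
    simp

theorem hasMellin_one_add_cpow {a b : ℂ} (ha : 0 < a.re) (hb : 0 < b.re) :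
    HasMellin (fun y : ℝ => (1 + y : ℂ) ^ (-(a + b))) a
      (Complex.Gamma a * Complex.Gamma b / Complex.Gamma (a + b)) := by
  have hab : 0 < (a + b).re := by simpa using add_pos ha hb
  have hw : ∀ u : ℝ, u ∈ Set.Ioi (0 : ℝ) →
      (u : ℂ) ^ (b - 1) • Complex.exp (-u) =
      ((u : ℂ) ^ (a + b - 1) * Complex.exp (-u)) * (u : ℂ) ^ (-a) := by
    intro u hu
    have : (u : ℂ) ≠ 0 := by exact_mod_cast (ne_of_gt hu)
    rw [show b - 1 = a + b - 1 + -a by ring, Complex.cpow_add _ _ this, smul_eq_mul]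
    ring
  have key := hasMellin_integral_comp_mul (ν := volume.restrict (Set.Ioi (0 : ℝ)))
    (k := fun x : ℝ => Complex.exp (-x)) (s := a) (by fun_prop) (hasMellin_cexp_neg ha)
    (w := fun u : ℝ => (u : ℂ) ^ (a + b - 1) * Complex.exp (-u)) (W := fun u => u)
    (by fun_prop) measurable_id (ae_restrict_mem measurableSet_Ioi)
    ((hasMellin_cexp_neg hb).1.congr_fun hw measurableSet_Ioi)
  have e1 : ∫ u in Set.Ioi (0 : ℝ), ((u : ℂ) ^ (a + b - 1) * Complex.exp (-u)) * (u : ℂ) ^ (-a)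
      = Complex.Gamma b := by
    rw [← (hasMellin_cexp_neg hb).2, mellin]
    exact (setIntegral_congr_fun measurableSet_Ioi hw).symm
  rw [e1] at key
  have hΓ : Complex.Gamma (a + b) ≠ 0 := Complex.Gamma_ne_zero_of_re_pos hab
  have e2 : ∀ z ∈ Set.Ioi (0 : ℝ), (∫ u in Set.Ioi (0 : ℝ),
      ((u : ℂ) ^ (a + b - 1) * Complex.exp (-u)) * Complex.exp (-((z * u : ℝ) : ℂ))) =
      Complex.Gamma (a + b) * (1 + z : ℂ) ^ (-(a + b)) := by
    intro z hz
    have hz : (0 : ℝ) < 1 + z := by have : 0 < z := hz; linarith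
    have := Complex.integral_cpow_mul_exp_neg_mul_Ioi hab hz
    rw [mul_comm (Complex.Gamma _), Complex.cpow_neg, ← Complex.inv_cpow]
    · rw [one_div] at this
      push_cast at this
      rw [← this]
      refine setIntegral_congr_fun measurableSet_Ioi fun u _ => ?_
      rw [mul_assoc, ← Complex.exp_add]
      push_cast
      ring_nf
    · have : (1 + z : ℂ) = ((1 + z : ℝ) : ℂ) := by push_cast; rfl
      rw [this, Complex.arg_ofReal_of_nonneg hz.le]
      exact Real.pi_pos.ne
  have h3 : ∀ z ∈ Set.Ioi (0 : ℝ), (z : ℂ) ^ (a - 1) • (∫ u in Set.Ioi (0 : ℝ),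
      ((u : ℂ) ^ (a + b - 1) * Complex.exp (-u)) * Complex.exp (-((z * u : ℝ) : ℂ))) =
      Complex.Gamma (a + b) * ((z : ℂ) ^ (a - 1) • (1 + z : ℂ) ^ (-(a + b))) := by
    intro z hz
    rw [e2 z hz, smul_eq_mul, smul_eq_mul]
    ring
  constructor
  · have h1 := key.1.congr_fun h3 measurableSet_Ioi
    have := h1.const_mul (Complex.Gamma (a + b))⁻¹
    refine this.congr (ae_of_all _ fun z => ?_)
    simp only
    rw [inv_mul_cancel_left₀ hΓ]
  · have h1 := key.2
    rw [mellin, setIntegral_congr_fun measurableSet_Ioi h3, integral_const_mul] at h1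
    rw [mellin, eq_div_iff hΓ, mul_comm, h1]
    ring

/-- Mellin transform of `(1 + z²)^t`. -/
theorem hasMellin_one_add_sq_cpow {s t : ℂ} (hs : 0 < s.re) (hst : s.re < -2 * t.re) :
    HasMellin (fun z : ℝ => (1 + (z : ℂ) ^ 2) ^ t) s
      (1 / 2 * (Complex.Gamma (s / 2) * Complex.Gamma (-t - s / 2) / Complex.Gamma (-t))) := by
  have ha : 0 < (s / 2).re := by simpa using hs
  have hb : 0 < (-t - s / 2).re := by simp; linarith
  have key := hasMellin_one_add_cpow ha hb
  have e0 : -(s / 2 + (-t - s / 2)) = t := by ring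
  rw [e0, show s / 2 + (-t - s / 2) = -t by ring] at key
  have e : (fun z : ℝ => (1 + (z : ℂ) ^ 2) ^ t) =
      fun z : ℝ => (fun y : ℝ => (1 + (y : ℂ)) ^ t) (z ^ (2 : ℝ)) := by
    funext z
    simp
  rw [e]
  constructor
  · refine (MellinConvergent.comp_rpow (f := fun y : ℝ => (1 + (y : ℂ)) ^ t) two_ne_zero).2 ?_
    simpa using key.1
  · rw [mellin_comp_rpow (fun y : ℝ => (1 + (y : ℂ)) ^ t)]
    have := key.2
    push_cast
    rw [this]
    simp

/-! ### Bounds on vertical lines -/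

theorem norm_Gamma_le {s : ℂ} (hs : 0 < s.re) : ‖Complex.Gamma s‖ ≤ Real.Gamma s.re := by
  rw [Complex.Gamma_eq_integral hs, Real.Gamma_eq_integral hs, Complex.GammaIntegral]
  refine (norm_integral_le_integral_norm _).trans_eq ?_
  refine setIntegral_congr_fun measurableSet_Ioi fun x hx => ?_
  simp only [norm_mul, Complex.norm_cpow_eq_rpow_re_of_pos hx, Complex.norm_real, Real.norm_eq_abs,
    abs_of_pos (Real.exp_pos _)]
  simp

/-- The Gamma function decays at least quadratically on vertical lines. -/
theorem norm_Gamma_le_div {x : ℝ} (hx : 0 < x) :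
    ∃ C, 0 < C ∧ ∀ s : ℂ, s.re = x → ‖Complex.Gamma s‖ ≤ C / (1 + s.im ^ 2) := by
  refine ⟨Real.Gamma (x + 2) / min 1 x, div_pos (Real.Gamma_pos_of_pos (by linarith))
    (lt_min one_pos hx), fun s hs => ?_⟩
  have h0 : s ≠ 0 := by rintro rfl; simp at hs; linarith
  have h1 : s + 1 ≠ 0 := by intro h; have := congrArg Complex.re h; simp at this; linarith
  have e : Complex.Gamma (s + 2) = (s + 1) * s * Complex.Gamma s := by
    rw [show s + 2 = s + 1 + 1 by ring, Complex.Gamma_add_one _ h1, Complex.Gamma_add_one _ h0]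
    ring
  have hb : ‖Complex.Gamma (s + 2)‖ ≤ Real.Gamma (x + 2) := by
    have := norm_Gamma_le (s := s + 2) (by simp; linarith)
    simpa [hs] using this
  rw [e, norm_mul, norm_mul] at hb
  have hm : 0 < min 1 x := lt_min one_pos hx
  have hlow : min 1 x * (1 + s.im ^ 2) ≤ ‖s + 1‖ * ‖s‖ := by
    rw [← norm_mul]
    refine le_of_sq_le_sq ?_ (norm_nonneg _)
    rw [Complex.sq_norm, map_mul, Complex.normSq_apply, Complex.normSq_apply]
    simp only [Complex.add_re, Complex.one_re, Complex.add_im, Complex.one_im, hs, add_zero]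
    have h1 : (min 1 x) ^ 2 * (1 + s.im ^ 2) ≤ x * x + s.im * s.im := by
      have ha : (min 1 x) ^ 2 ≤ 1 := by
        have := min_le_left 1 x; nlinarith
      have hb : (min 1 x) ^ 2 ≤ x ^ 2 := by
        have := min_le_right 1 x; nlinarith
      nlinarith [sq_nonneg s.im]
    have h2 : (1 + s.im ^ 2) ≤ (x + 1) * (x + 1) + s.im * s.im := by nlinarith
    calc (min 1 x * (1 + s.im ^ 2)) ^ 2 = (1 + s.im ^ 2) * ((min 1 x) ^ 2 * (1 + s.im ^ 2)) := by
          ring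
      _ ≤ _ := mul_le_mul h2 h1 (by positivity)
          (add_nonneg (mul_self_nonneg _) (mul_self_nonneg _))
  rw [div_div, le_div_iff₀ (by positivity)]
  calc _ = (min 1 x * (1 + s.im ^ 2)) * ‖Complex.Gamma s‖ := by ring
    _ ≤ ‖s + 1‖ * ‖s‖ * ‖Complex.Gamma s‖ := by gcongr
    _ ≤ _ := hb

theorem norm_one_add_cpow {y : ℝ} (hy : 0 < y) (t : ℂ) :
    ‖(1 + (y : ℂ)) ^ t‖ = (1 + y) ^ t.re := by
  rw [← Complex.norm_cpow_eq_rpow_re_of_pos (by linarith : 0 < 1 + y)]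
  push_cast
  rfl

/-- The Beta function `B(a, -t - a)`, written as a Mellin transform, decays in `Im t`. -/
theorem norm_mellin_one_add_cpow_le {c g : ℝ} (hg : 0 < g) (hg1 : g ≤ 1) (hgc : g < -c) :
    ∃ C, 0 < C ∧ ∀ t a : ℂ, t.re = c → 1 ≤ |t.im| → a.re = g →
      ‖mellin (fun y : ℝ => (1 + (y : ℂ)) ^ t) a‖ ≤ C * (1 + ‖a‖) * |t.im| ^ (-(g / 2)) := by
  have hc : c < 0 := by linarith
  have conv : ∀ t a : ℂ, t.re = c → a.re = g →
      MellinConvergent (fun y : ℝ => (1 + (y : ℂ)) ^ t) a := by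
    intro t a ht ha
    have := (hasMellin_one_add_cpow (a := a) (b := -t - a) (by linarith)
      (by simp [ht, ha]; linarith)).1
    rwa [show -(a + (-t - a)) = t by ring] at this
  have normeq : ∀ t a : ℂ, t.re = c → a.re = g → ∀ y ∈ Set.Ioi (0 : ℝ),
      ‖(y : ℂ) ^ (a - 1) • (1 + (y : ℂ)) ^ t‖ = y ^ (g - 1) * (1 + y) ^ c := by
    intro t a ht ha y hy
    rw [norm_smul, Complex.norm_cpow_eq_rpow_re_of_pos hy, norm_one_add_cpow hy, ht]
    simp [ha]
  have hBint : IntegrableOn (fun y : ℝ => y ^ (g - 1) * (1 + y) ^ c) (Set.Ioi 0) := by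
    have := (conv c g (by simp) (by simp)).norm
    exact IntegrableOn.congr_fun this (normeq c g (by simp) (by simp)) measurableSet_Ioi
  set B : ℝ := ∫ y in Set.Ioi (0 : ℝ), y ^ (g - 1) * (1 + y) ^ c with hB
  have hB0 : 0 ≤ B := setIntegral_nonneg measurableSet_Ioi fun y hy => by
    have : 0 < y := hy
    positivity
  refine ⟨1 / g + 2 + 2 * B, by positivity, fun t a ht hv ha => ?_⟩
  set ε : ℝ := |t.im| ^ (-(1 / 2) : ℝ) with hε
  have hv0 : 0 < |t.im| := by linarith
  have hε0 : 0 < ε := Real.rpow_pos_of_pos hv0 _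
  have hε1 : ε ≤ 1 := Real.rpow_le_one_of_one_le_of_nonpos hv (by norm_num)
  have ht1 : |t.im| ≤ ‖t + 1‖ := by
    have := Complex.abs_im_le_norm (t + 1)
    simpa using this
  have ht10 : t + 1 ≠ 0 := by
    intro h; rw [h] at ht1; simp at ht1; rw [ht1] at hv; norm_num at hv
  have hconv := conv t a ht ha
  have hsplit : mellin (fun y : ℝ => (1 + (y : ℂ)) ^ t) a =
      (∫ y in Set.Ioc 0 ε, (y : ℂ) ^ (a - 1) • (1 + (y : ℂ)) ^ t) +
      ∫ y in Set.Ioi ε, (y : ℂ) ^ (a - 1) • (1 + (y : ℂ)) ^ t := by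
    rw [mellin, ← Set.Ioc_union_Ioi_eq_Ioi hε0.le]
    exact setIntegral_union Set.Ioc_disjoint_Ioi_same measurableSet_Ioi
      (hconv.mono_set Set.Ioc_subset_Ioi_self) (hconv.mono_set (Set.Ioi_subset_Ioi hε0.le))
  have hfirst : ‖∫ y in Set.Ioc 0 ε, (y : ℂ) ^ (a - 1) • (1 + (y : ℂ)) ^ t‖ ≤ ε ^ g / g := by
    have hint : IntervalIntegrable (fun y : ℝ => y ^ (g - 1)) volume 0 ε :=
      intervalIntegral.intervalIntegrable_rpow' (by linarith)
    have hval : ∫ y in Set.Ioc 0 ε, y ^ (g - 1) = ε ^ g / g := by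
      rw [← intervalIntegral.integral_of_le hε0.le, integral_rpow (Or.inl (by linarith))]
      simp [hg.ne']
    rw [← hval]
    refine norm_integral_le_of_norm_le ((intervalIntegrable_iff_integrableOn_Ioc_of_le hε0.le).1
      hint) ((ae_restrict_iff' measurableSet_Ioc).2 (ae_of_all _ fun y hy => ?_))
    have hy0 : 0 < y := hy.1
    rw [normeq t a ht ha y hy0]
    exact mul_le_of_le_one_right (by positivity)
      (Real.rpow_le_one_of_one_le_of_nonpos (by linarith) hc.le)
  have hone : ∀ y : ℝ, 0 < y → ‖(1 + (y : ℂ)) ^ (t + 1) / (t + 1)‖ ≤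
      (1 + y) ^ c * (1 + y) / |t.im| := by
    intro y hy
    rw [norm_div, norm_one_add_cpow hy, Complex.add_re, ht, Complex.one_re,
      Real.rpow_add (by linarith), Real.rpow_one]
    gcongr
  have hbound : ∀ y ∈ Set.Ioi ε, ‖((a - 1) * (y : ℂ) ^ (a - 1 - 1)) *
      ((1 + (y : ℂ)) ^ (t + 1) / (t + 1))‖ ≤
      (‖a - 1‖ * (2 / ε) / |t.im|) * (y ^ (g - 1) * (1 + y) ^ c) := by
    intro y hy
    have hy0 : 0 < y := lt_trans hε0 hy
    rw [norm_mul, norm_mul, Complex.norm_cpow_eq_rpow_re_of_pos hy0]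
    have e : y ^ (a - 1 - 1).re = y ^ (g - 1) / y := by
      rw [← Real.rpow_sub_one hy0.ne']; simp [ha]
    rw [e]
    have h2 : (1 + y) / y ≤ 2 / ε := by
      have hy' : ε < y := hy
      rw [div_le_div_iff₀ hy0 hε0]
      nlinarith
    calc _ ≤ ‖a - 1‖ * (y ^ (g - 1) / y) * ((1 + y) ^ c * (1 + y) / |t.im|) := by
          gcongr; exact hone y hy0
      _ = (‖a - 1‖ / |t.im| * (y ^ (g - 1) * (1 + y) ^ c)) * ((1 + y) / y) := by ring
      _ ≤ (‖a - 1‖ / |t.im| * (y ^ (g - 1) * (1 + y) ^ c)) * (2 / ε) := by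
          gcongr
      _ = _ := by ring
  have hdom : IntegrableOn (fun y : ℝ => (‖a - 1‖ * (2 / ε) / |t.im|) *
      (y ^ (g - 1) * (1 + y) ^ c)) (Set.Ioi ε) :=
    (hBint.mono_set (Set.Ioi_subset_Ioi hε0.le)).const_mul _
  have hparts := integral_Ioi_mul_deriv_eq_deriv_mul (a := ε) (A := ℂ)
    (u := fun y : ℝ => (y : ℂ) ^ (a - 1)) (u' := fun y : ℝ => (a - 1) * (y : ℂ) ^ (a - 1 - 1))
    (v := fun y : ℝ => (1 + (y : ℂ)) ^ (t + 1) / (t + 1)) (v' := fun y : ℝ => (1 + (y : ℂ)) ^ t)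
    (a' := (ε : ℂ) ^ (a - 1) * ((1 + (ε : ℂ)) ^ (t + 1) / (t + 1))) (b' := 0)
    (by
      intro y hy
      have hy0 : 0 < y := lt_trans hε0 hy
      have := ((hasDerivAt_id (y : ℂ)).cpow_const (c := a - 1)
        (Or.inl (by simpa using hy0))).comp_ofReal
      simpa using this)
    (by
      intro y hy
      have hy0 : 0 < y := lt_trans hε0 hy
      have := ((((hasDerivAt_id (y : ℂ)).const_add 1).cpow_const (c := t + 1)
        (Or.inl (by simp; linarith))).div_const (t + 1)).comp_ofReal
      simpa [mul_div_assoc, mul_div_cancel_left₀ _ ht10] using this)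
    (hconv.mono_set (Set.Ioi_subset_Ioi hε0.le))
    (by
      refine Integrable.mono' hdom ?_ ((ae_restrict_iff' measurableSet_Ioi).2
        (ae_of_all _ hbound))
      refine Measurable.aestronglyMeasurable ?_
      simp only [Pi.mul_def]
      fun_prop)
    (by
      refine tendsto_nhdsWithin_of_tendsto_nhds (ContinuousAt.tendsto (x := ε) ?_)
      have h1 : (ε : ℂ) ∈ Complex.slitPlane := Or.inl (by simpa using hε0)
      have h2 : 1 + (ε : ℂ) ∈ Complex.slitPlane := Or.inl (by simp; linarith)
      refine ContinuousAt.mul ?_ (ContinuousAt.div_const ?_ _)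
      · exact (continuousAt_cpow_const h1).comp Complex.continuous_ofReal.continuousAt
      · exact ContinuousAt.comp (f := fun y : ℝ => 1 + (y : ℂ)) (g := fun z : ℂ => z ^ (t + 1))
          (continuousAt_cpow_const h2) (by fun_prop))
    (by
      have hlim : Filter.Tendsto (fun y : ℝ => 2 / |t.im| * y ^ (-(-c - g))) Filter.atTop
          (nhds 0) := by
        simpa using (tendsto_rpow_neg_atTop (by linarith : 0 < -c - g)).const_mul (2 / |t.im|)
      refine squeeze_zero_norm' ?_ hlim
      filter_upwards [Filter.eventually_ge_atTop 1] with y hy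
      have hy0 : 0 < y := by linarith
      rw [Pi.mul_apply, norm_mul, Complex.norm_cpow_eq_rpow_re_of_pos hy0]
      have h1 : (1 + y) ^ c ≤ y ^ c :=
        Real.rpow_le_rpow_of_nonpos hy0 (by linarith) hc.le
      calc _ ≤ y ^ (a - 1).re * ((1 + y) ^ c * (1 + y) / |t.im|) := by
            gcongr; exact hone y hy0
        _ ≤ y ^ (a - 1).re * (y ^ c * (2 * y) / |t.im|) := by
            gcongr; linarith
        _ = 2 / |t.im| * (y ^ (g - 1) * y ^ c * y ^ (1 : ℝ)) := by
            simp [ha]; ring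
        _ = _ := by
            rw [← Real.rpow_add hy0, ← Real.rpow_add hy0]
            ring_nf)
  have hsecond : ‖∫ y in Set.Ioi ε, (y : ℂ) ^ (a - 1) • (1 + (y : ℂ)) ^ t‖ ≤
      2 / (ε * |t.im|) * (1 + ‖a - 1‖ * B) := by
    simp only [smul_eq_mul]
    rw [hparts, zero_sub]
    refine (norm_sub_le _ _).trans ?_
    rw [norm_neg]
    have h1 : ‖(ε : ℂ) ^ (a - 1) * ((1 + (ε : ℂ)) ^ (t + 1) / (t + 1))‖ ≤ 2 / (ε * |t.im|) := by
      rw [norm_mul, Complex.norm_cpow_eq_rpow_re_of_pos hε0]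
      have e1 : ε ^ (a - 1).re ≤ ε⁻¹ := by
        rw [← Real.rpow_neg_one]
        exact Real.rpow_le_rpow_of_exponent_ge hε0 hε1 (by simp [ha]; linarith)
      have e2 : (1 + ε) ^ c ≤ 1 := Real.rpow_le_one_of_one_le_of_nonpos (by linarith) hc.le
      calc _ ≤ ε⁻¹ * ((1 + ε) ^ c * (1 + ε) / |t.im|) := by
            gcongr; exact hone ε hε0
        _ ≤ ε⁻¹ * (1 * 2 / |t.im|) := by gcongr; linarith
        _ = _ := by field_simp
    have h2 : ‖∫ y in Set.Ioi ε, ((a - 1) * (y : ℂ) ^ (a - 1 - 1)) *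
        ((1 + (y : ℂ)) ^ (t + 1) / (t + 1))‖ ≤ (‖a - 1‖ * (2 / ε) / |t.im|) * B := by
      refine (norm_integral_le_of_norm_le hdom ((ae_restrict_iff' measurableSet_Ioi).2
        (ae_of_all _ hbound))).trans ?_
      rw [integral_const_mul]
      gcongr
      refine setIntegral_mono_set hBint ((ae_restrict_iff' measurableSet_Ioi).2
        (ae_of_all _ fun y hy => ?_)) (Set.Ioi_subset_Ioi hε0.le).eventuallyLE
      have : 0 < y := hy
      simp only [Pi.zero_apply]
      positivity
    calc _ ≤ 2 / (ε * |t.im|) + (‖a - 1‖ * (2 / ε) / |t.im|) * B := add_le_add h1 h2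
      _ = _ := by field_simp
  have hεg : ε ^ g = |t.im| ^ (-(g / 2)) := by
    rw [hε, ← Real.rpow_mul hv0.le]; ring_nf
  have hεv : (ε * |t.im|)⁻¹ ≤ |t.im| ^ (-(g / 2)) := by
    have : ε * |t.im| = |t.im| ^ (1 / 2 : ℝ) := by
      rw [hε]
      nth_rewrite 2 [← Real.rpow_one |t.im|]
      rw [← Real.rpow_add hv0]; norm_num
    rw [this, ← Real.rpow_neg hv0.le]
    exact Real.rpow_le_rpow_of_exponent_le hv (by linarith)
  have ha1 : ‖a - 1‖ ≤ 1 + ‖a‖ := by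
    have := norm_sub_le a 1
    simp at this; linarith
  rw [hsplit]
  set D := |t.im| ^ (-(g / 2)) with hD
  have hD0 : 0 ≤ D := by positivity
  have ha0 := norm_nonneg a
  calc _ ≤ ε ^ g / g + 2 / (ε * |t.im|) * (1 + ‖a - 1‖ * B) :=
        (norm_add_le _ _).trans (add_le_add hfirst hsecond)
    _ = D * (1 / g) + 2 * (ε * |t.im|)⁻¹ * (1 + ‖a - 1‖ * B) := by rw [hεg]; ring
    _ ≤ D * (1 / g * (1 + ‖a‖)) + 2 * D * ((1 + ‖a‖) + (1 + ‖a‖) * B) := by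
        gcongr
        · have : 0 ≤ 1 / g * ‖a‖ := by positivity
          linarith
        · linarith
    _ = _ := by ring

/-! ### The upper incomplete Gamma function -/

theorem integrableOn_upperGamma (p : ℝ) {x : ℝ} (hx : 0 < x) :
    IntegrableOn (fun u : ℝ => u ^ (p - 1) * Real.exp (-u)) (Set.Ioi x) := by
  refine integrable_of_isBigO_exp_neg (b := 1 / 2) (by norm_num) ?_
    ((Real.Gamma_integrand_isLittleO (p - 1)).isBigO.congr_left fun u => mul_comm _ _)
  refine ContinuousOn.mul (fun u hu => ?_) (by fun_prop)
  exact (Real.continuousAt_rpow_const _ _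
    (Or.inl (lt_of_lt_of_le hx hu).ne')).continuousWithinAt

theorem upperGamma_nonneg (p : ℝ) {x : ℝ} (hx : 0 ≤ x) : 0 ≤ upperGamma p x :=
  setIntegral_nonneg measurableSet_Ioi fun u hu => by
    have : 0 < u := lt_of_le_of_lt hx hu
    positivity

theorem hasDerivAt_upperGamma (p : ℝ) {x : ℝ} (hx : 0 < x) :
    HasDerivAt (upperGamma p) (-(x ^ (p - 1) * Real.exp (-x))) x := by
  have hi := integrableOn_upperGamma p (half_pos hx)
  have hcont : ∀ u : ℝ, 0 < u → ContinuousAt (fun u : ℝ => u ^ (p - 1) * Real.exp (-u)) u :=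
    fun u hu => (Real.continuousAt_rpow_const _ _ (Or.inl hu.ne')).mul (by fun_prop)
  have hloc : ∀ y ∈ Set.Ioi (x / 2), upperGamma p y =
      upperGamma p (x / 2) - ∫ u in (x / 2)..y, u ^ (p - 1) * Real.exp (-u) := by
    intro y hy
    have hy' : x / 2 ≤ y := le_of_lt hy
    rw [intervalIntegral.integral_of_le hy', upperGamma, upperGamma, eq_sub_iff_add_eq,
      ← Set.Ioc_union_Ioi_eq_Ioi hy', add_comm]
    exact (setIntegral_union Set.Ioc_disjoint_Ioi_same measurableSet_Ioi
      (hi.mono_set Set.Ioc_subset_Ioi_self) (hi.mono_set (Set.Ioi_subset_Ioi hy'))).symm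
  have hd : HasDerivAt (fun y => ∫ u in (x / 2)..y, u ^ (p - 1) * Real.exp (-u))
      (x ^ (p - 1) * Real.exp (-x)) x := by
    refine intervalIntegral.integral_hasDerivAt_right ?_ ?_ (hcont x hx)
    · rw [intervalIntegrable_iff_integrableOn_Ioc_of_le (by linarith)]
      exact hi.mono_set Set.Ioc_subset_Ioi_self
    · exact (by fun_prop : Measurable fun u : ℝ => u ^ (p - 1) * Real.exp (-u))
        |>.stronglyMeasurable.stronglyMeasurableAtFilter
  refine (hd.const_sub (upperGamma p (x / 2))).congr_of_eventuallyEq ?_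
  filter_upwards [Ioi_mem_nhds (by linarith : x / 2 < x)] with y hy using hloc y hy

/-! ### The fading law -/

/-- The scale `(μ / (hf^α S^α))^(-1/α)` of the fading law. -/
noncomputable def fadingScale (α μ S hf : ℝ) : ℝ := (μ / (hf ^ α * S ^ α)) ^ (-(1 / α))

/-- The law of the magnitude of a fading coefficient. -/
noncomputable def fadingLaw (α μ φ S hf : ℝ) : Measure ℝ :=
  (volume.restrict (Set.Ioi 0)).withDensity fun x => ENNReal.ofReal (fadingPDF α μ φ S hf x)

section
variable {α μ φ S hf : ℝ}

theorem fadingScale_pos (hμ : 0 < μ) (hS : 0 < S) (hhf : 0 < hf) : 0 < fadingScale α μ S hf := by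
  unfold fadingScale; positivity

theorem fadingScale_rpow (hα : 0 < α) (hμ : 0 < μ) (hS : 0 < S) (hhf : 0 < hf) (q : ℝ) :
    fadingScale α μ S hf ^ q = S ^ q * hf ^ q / μ ^ (q / α) := by
  unfold fadingScale
  rw [← Real.rpow_mul (by positivity), Real.div_rpow hμ.le (by positivity),
    Real.mul_rpow (by positivity) (by positivity), ← Real.rpow_mul hhf.le, ← Real.rpow_mul hS.le,
    show α * (-(1 / α) * q) = -q by field_simp, show -(1 / α) * q = -(q / α) by ring,
    Real.rpow_neg hhf.le, Real.rpow_neg hS.le, Real.rpow_neg hμ.le]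
  field_simp

theorem div_fadingScale_rpow (hα : 0 < α) (hμ : 0 < μ) (hS : 0 < S) (hhf : 0 < hf) {x : ℝ}
    (hx : 0 ≤ x) : (x / fadingScale α μ S hf) ^ α = μ * x ^ α / (S ^ α * hf ^ α) := by
  rw [Real.div_rpow hx (fadingScale_pos hμ hS hhf).le, fadingScale_rpow hα hμ hS hhf,
    div_self hα.ne', Real.rpow_one]
  field_simp

theorem fadingPDF_eq (hα : 0 < α) (hμ : 0 < μ) (hS : 0 < S) (hhf : 0 < hf) {x : ℝ}
    (hx : 0 < x) : fadingPDF α μ φ S hf x =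
      φ / (fadingScale α μ S hf ^ φ * Real.Gamma μ) * (x ^ (φ - 1) *
        upperGamma (μ - φ / α) ((x / fadingScale α μ S hf) ^ α)) := by
  rw [fadingPDF, div_fadingScale_rpow hα hμ hS hhf hx.le, fadingScale_rpow hα hμ hS hhf,
    show (α * μ - φ) / α = μ - φ / α by field_simp]
  have := Real.Gamma_pos_of_pos hμ
  field_simp

theorem fadingPDF_nonneg (hμ : 0 < μ) (hφ : 0 < φ) (hS : 0 < S)
    (hhf : 0 < hf) {x : ℝ} (hx : 0 < x) : 0 ≤ fadingPDF α μ φ S hf x := by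
  have := Real.Gamma_pos_of_pos hμ
  have := upperGamma_nonneg ((α * μ - φ) / α) (x := μ * x ^ α / (S ^ α * hf ^ α)) (by positivity)
  unfold fadingPDF
  positivity

theorem continuousOn_fadingPDF (hμ : 0 < μ) (hS : 0 < S) (hhf : 0 < hf) :
    ContinuousOn (fadingPDF α μ φ S hf) (Set.Ioi 0) := by
  intro x hx
  have hx : 0 < x := hx
  refine ContinuousAt.continuousWithinAt ?_
  have h1 : ∀ q : ℝ, ContinuousAt (fun x : ℝ => x ^ q) x := fun q =>
    Real.continuousAt_rpow_const _ _ (Or.inl hx.ne')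
  refine ContinuousAt.mul (((h1 _).const_mul _).div_const _) ?_
  refine ContinuousAt.comp (g := upperGamma ((α * μ - φ) / α))
    (f := fun x : ℝ => μ * x ^ α / (S ^ α * hf ^ α))
    (hasDerivAt_upperGamma _ (by positivity)).continuousAt (((h1 _).const_mul _).div_const _)

theorem ae_pos_fadingLaw : ∀ᵐ x ∂fadingLaw α μ φ S hf, 0 < x :=
  (withDensity_absolutelyContinuous _ _).ae_le (ae_restrict_mem measurableSet_Ioi)

instance nullSingletonClass_fadingLaw : NullSingletonClass (fadingLaw α μ φ S hf) :=
  inferInstanceAs (NullSingletonClass (Measure.withDensity _ _))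

theorem integral_fadingLaw (hμ : 0 < μ) (hφ : 0 < φ) (hS : 0 < S) (hhf : 0 < hf) (f : ℝ → ℂ) :
    ∫ x, f x ∂fadingLaw α μ φ S hf =
      ∫ x in Set.Ioi 0, (fadingPDF α μ φ S hf x : ℂ) * f x := by
  have hm := ((continuousOn_fadingPDF (α := α) (φ := φ) hμ hS hhf).aemeasurable
    measurableSet_Ioi (μ := volume)).ennreal_ofReal
  rw [fadingLaw, integral_withDensity_eq_integral_toReal_smul₀ hm
    (ae_of_all _ fun _ => ENNReal.ofReal_lt_top)]
  refine setIntegral_congr_fun measurableSet_Ioi fun x hx => ?_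
  simp only [ENNReal.toReal_ofReal (fadingPDF_nonneg hμ hφ hS hhf hx), Complex.real_smul]

theorem integrable_fadingLaw_iff (hμ : 0 < μ) (hφ : 0 < φ) (hS : 0 < S) (hhf : 0 < hf)
    (f : ℝ → ℂ) : Integrable f (fadingLaw α μ φ S hf) ↔
      IntegrableOn (fun x => (fadingPDF α μ φ S hf x : ℂ) * f x) (Set.Ioi 0) := by
  have hm := ((continuousOn_fadingPDF (α := α) (φ := φ) hμ hS hhf).aemeasurable
    measurableSet_Ioi (μ := volume)).ennreal_ofReal
  rw [fadingLaw, integrable_withDensity_iff_integrable_smul₀' hm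
    (ae_of_all _ fun _ => ENNReal.ofReal_lt_top)]
  refine integrableOn_congr_fun (fun x hx => ?_) measurableSet_Ioi
  simp only [ENNReal.toReal_ofReal (fadingPDF_nonneg hμ hφ hS hhf hx), Complex.real_smul]

theorem hasMellin_upperGamma_rpow {p a : ℝ} (hα : 0 < α) (ha : 0 < a) {r : ℂ} (hr : 0 < r.re)
    (hrp : 0 < p + r.re / α) :
    HasMellin (fun x : ℝ => (upperGamma p ((x / a) ^ α) : ℂ)) r
      ((a : ℂ) ^ r * Complex.Gamma (p + r / α) * (1 / r)) := by
  set k : ℝ → ℂ := (Set.Ioc 0 1).indicator fun _ => 1 with hk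
  set w : ℝ → ℂ := fun u => ((u ^ (p - 1) * Real.exp (-u) : ℝ) : ℂ) with hw
  set W : ℝ → ℝ := fun u => (a * u ^ (1 / α))⁻¹ with hW
  have hpr : 0 < (p + r / α : ℂ).re := by simpa [Complex.div_ofReal_re] using hrp
  have hwW : ∀ u ∈ Set.Ioi (0 : ℝ), w u * (W u : ℂ) ^ (-r) =
      (a : ℂ) ^ r * ((u : ℂ) ^ (p + r / α - 1) • Complex.exp (-u)) := by
    intro u hu
    have hu : 0 < u := hu
    have hu' : (u : ℂ) ≠ 0 := by exact_mod_cast hu.ne'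
    have e1 : (W u : ℂ) ^ (-r) = (a : ℂ) ^ r * (u : ℂ) ^ (r / α) := by
      have hpos : 0 < a * u ^ (1 / α) := by positivity
      rw [hW, Complex.ofReal_inv, Complex.cpow_neg, Complex.inv_cpow, inv_inv, Complex.ofReal_mul,
        Complex.mul_cpow_ofReal_nonneg ha.le (by positivity), ← Complex.cpow_mul_ofReal_nonneg hu.le]
      · congr 2
        push_cast
        ring
      · rw [Complex.arg_ofReal_of_nonneg hpos.le]
        exact Real.pi_pos.ne
    rw [e1, show p + r / α - 1 = ((p - 1 : ℝ) : ℂ) + r / α by push_cast; ring,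
      Complex.cpow_add _ _ hu', hw]
    simp only [smul_eq_mul]
    rw [Complex.ofReal_mul, Complex.ofReal_cpow hu.le, Complex.ofReal_exp]
    push_cast
    ring
  have key := hasMellin_integral_comp_mul (ν := volume.restrict (Set.Ioi (0 : ℝ))) (k := k)
    (s := r) (measurable_const.indicator measurableSet_Ioc) (hasMellin_one_Ioc hr)
    (w := w) (W := W) (by fun_prop) (by fun_prop)
    ((ae_restrict_mem measurableSet_Ioi).mono fun u hu => by
      have : 0 < u := hu
      positivity)
    (IntegrableOn.congr_fun ((hasMellin_cexp_neg hpr).1.const_mul _)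
      (fun u hu => (hwW u hu).symm) measurableSet_Ioi)
  rw [setIntegral_congr_fun measurableSet_Ioi hwW, integral_const_mul,
    show (∫ u in Set.Ioi (0 : ℝ), (u : ℂ) ^ (p + r / α - 1) • Complex.exp (-u)) =
      Complex.Gamma (p + r / α) from (hasMellin_cexp_neg hpr).2] at key
  have e : ∀ x ∈ Set.Ioi (0 : ℝ), ∫ u in Set.Ioi (0 : ℝ), w u * k (x * W u) =
      (upperGamma p ((x / a) ^ α) : ℂ) := by
    intro x hx
    have hx : 0 < x := hx
    have hxa : 0 < (x / a) ^ α := by positivity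
    have h1 : ∀ u ∈ Set.Ioi (0 : ℝ), w u * k (x * W u) =
        (Set.Ici ((x / a) ^ α)).indicator w u := by
      intro u hu
      have hu : 0 < u := hu
      have hiff : x * W u ∈ Set.Ioc (0 : ℝ) 1 ↔ u ∈ Set.Ici ((x / a) ^ α) := by
        have hWu : 0 < W u := by positivity
        simp only [Set.mem_Ioc, Set.mem_Ici, mul_pos hx hWu, true_and]
        rw [hW]
        simp only
        rw [← div_eq_mul_inv, div_le_one (by positivity), ← div_le_iff₀' ha, one_div,
          Real.le_rpow_inv_iff_of_pos (by positivity) hu.le hα]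
      by_cases h : u ∈ Set.Ici ((x / a) ^ α)
      · rw [Set.indicator_of_mem h, hk, Set.indicator_of_mem (hiff.2 h), mul_one]
      · rw [Set.indicator_of_notMem h, hk, Set.indicator_of_notMem (mt hiff.1 h), mul_zero]
    rw [setIntegral_congr_fun measurableSet_Ioi h1, setIntegral_indicator measurableSet_Ici,
      Set.inter_eq_right.2 (Set.Ici_subset_Ioi.2 hxa), integral_Ici_eq_integral_Ioi, upperGamma]
    exact integral_complex_ofReal
  have e' : ∀ x ∈ Set.Ioi (0 : ℝ), (x : ℂ) ^ (r - 1) • ∫ u in Set.Ioi (0 : ℝ), w u * k (x * W u) =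
      (x : ℂ) ^ (r - 1) • (upperGamma p ((x / a) ^ α) : ℂ) := fun x hx => by rw [e x hx]
  constructor
  · exact key.1.congr_fun e' measurableSet_Ioi
  · rw [mellin, ← setIntegral_congr_fun measurableSet_Ioi e']
    exact key.2

/-- Negative moments of the fading law. -/
theorem fadingLaw_moment (hα : 0 < α) (hμ : 0 < μ) (hφ : 0 < φ) (hS : 0 < S) (hhf : 0 < hf)
    {s : ℂ} (hs1 : s.re < φ) (hs2 : s.re / α < μ) :
    Integrable (fun x : ℝ => (x : ℂ) ^ (-s)) (fadingLaw α μ φ S hf) ∧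
    ∫ x : ℝ, (x : ℂ) ^ (-s) ∂fadingLaw α μ φ S hf =
      (fadingScale α μ S hf : ℂ) ^ (-s) * φ / Real.Gamma μ *
        (Complex.Gamma (μ - s / α) / (φ - s)) := by
  set a := fadingScale α μ S hf with ha
  have ha0 : 0 < a := fadingScale_pos hμ hS hhf
  have hΓ := Real.Gamma_pos_of_pos hμ
  have key := hasMellin_upperGamma_rpow (α := α) (p := μ - φ / α) (a := a) hα ha0 (r := φ - s)
    (by simpa using hs1) (by
      simp only [Complex.sub_re, Complex.ofReal_re]
      have : μ - φ / α + (φ - s.re) / α = μ - s.re / α := by ring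
      linarith)
  have e : ∀ x ∈ Set.Ioi (0 : ℝ), (fadingPDF α μ φ S hf x : ℂ) * (x : ℂ) ^ (-s) =
      (φ / (a ^ φ * Real.Gamma μ) : ℝ) *
        ((x : ℂ) ^ (φ - s - 1) • (upperGamma (μ - φ / α) ((x / a) ^ α) : ℂ)) := by
    intro x hx
    have hx : 0 < x := hx
    rw [fadingPDF_eq hα hμ hS hhf hx, show φ - s - 1 = ((φ - 1 : ℝ) : ℂ) + -s by push_cast; ring,
      Complex.cpow_add _ _ (by exact_mod_cast hx.ne'), smul_eq_mul, Complex.ofReal_mul,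
      Complex.ofReal_mul, Complex.ofReal_cpow hx.le]
    ring
  constructor
  · rw [integrable_fadingLaw_iff hμ hφ hS hhf]
    exact IntegrableOn.congr_fun (key.1.const_mul _) (fun x hx => (e x hx).symm) measurableSet_Ioi
  · have h2 := key.2
    rw [mellin] at h2
    rw [integral_fadingLaw hμ hφ hS hhf, setIntegral_congr_fun measurableSet_Ioi e,
      integral_const_mul, h2, show (φ : ℂ) - s = φ + -s by ring,
      Complex.cpow_add _ _ (by exact_mod_cast ha0.ne'), ← Complex.ofReal_cpow ha0.le]
    have h3 : ((a ^ φ : ℝ) : ℂ) ≠ 0 := by exact_mod_cast (Real.rpow_pos_of_pos ha0 φ).ne'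
    have h4 : (Real.Gamma μ : ℂ) ≠ 0 := by exact_mod_cast hΓ.ne'
    have h5 : ((μ - φ / α : ℝ) : ℂ) + (φ + -s) / α = μ - s / α := by push_cast; ring
    rw [h5]
    push_cast at h3 ⊢
    field_simp

end

theorem norm_one_add_sq_cpow (r : ℝ) (t : ℂ) :
    ‖(1 + (r : ℂ) ^ 2) ^ t‖ = (1 + r ^ 2) ^ t.re := by
  rw [← Complex.norm_cpow_eq_rpow_re_of_pos (by positivity : 0 < 1 + r ^ 2)]
  push_cast
  rfl

theorem norm_one_add_sq_cpow_le_one (r : ℝ) {t : ℂ} (ht : t.re ≤ 0) :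
    ‖(1 + (r : ℂ) ^ 2) ^ t‖ ≤ 1 := by
  rw [norm_one_add_sq_cpow]
  exact Real.rpow_le_one_of_one_le_of_nonpos (by nlinarith [sq_nonneg r]) ht

theorem continuous_one_add_sq_cpow (t : ℂ) : Continuous fun r : ℝ => (1 + (r : ℂ) ^ 2) ^ t := by
  refine Continuous.cpow (by fun_prop) continuous_const fun r => Or.inl ?_
  rw [← Complex.ofReal_pow, Complex.add_re, Complex.ofReal_re, Complex.one_re]
  positivity

theorem continuous_Gamma_comp {X : Type*} [TopologicalSpace X] {f : X → ℂ} (hf : Continuous f)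
    (h : ∀ x, 0 < (f x).re) : Continuous fun x => Complex.Gamma (f x) := by
  refine continuous_iff_continuousAt.2 fun x => ?_
  refine ContinuousAt.comp (g := Complex.Gamma) ?_ hf.continuousAt
  refine (Complex.differentiableAt_Gamma _ fun m hm => ?_).continuousAt
  have := h x
  rw [hm] at this
  simp at this
  have h0 : (0 : ℝ) ≤ m := m.cast_nonneg
  linarith

/-- Mellin transform, at `s`, of `z ↦ E (1 + (z X)²)^t` for a fading magnitude `X`. -/
noncomputable def fadingMellin (α μ φ S hf : ℝ) (t s : ℂ) : ℂ :=
  (fadingScale α μ S hf : ℂ) ^ (-s) * φ / Real.Gamma μ * (Complex.Gamma (μ - s / α) / (φ - s)) *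
    (1 / 2 * (Complex.Gamma (s / 2) * Complex.Gamma (-t - s / 2) / Complex.Gamma (-t)))

section
variable {α μ φ S hf : ℝ}

theorem hasMellin_fading [IsFiniteMeasure (fadingLaw α μ φ S hf)] (hα : 0 < α) (hμ : 0 < μ)
    (hφ : 0 < φ) (hS : 0 < S) (hhf : 0 < hf) {s t : ℂ} (hs0 : 0 < s.re) (hs1 : s.re < φ)
    (hs2 : s.re / α < μ) (hs3 : s.re < -2 * t.re) :
    HasMellin (fun z : ℝ => ∫ x, (1 + ((z * x : ℝ) : ℂ) ^ 2) ^ t ∂fadingLaw α μ φ S hf) s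
      (fadingMellin α μ φ S hf t s) := by
  have hmom := fadingLaw_moment hα hμ hφ hS hhf hs1 hs2
  have key := hasMellin_integral_comp_mul (ν := fadingLaw α μ φ S hf)
    (k := fun z : ℝ => (1 + (z : ℂ) ^ 2) ^ t) (s := s) (continuous_one_add_sq_cpow t).measurable
    (hasMellin_one_add_sq_cpow hs0 hs3) (w := fun _ => 1) (W := fun x => x)
    aestronglyMeasurable_const measurable_id ae_pos_fadingLaw (by simpa using hmom.1)
  simp only [one_mul] at key
  rw [hmom.2] at key
  exact key

/-- The moment factor of `fadingMellin` decays quadratically on vertical lines. -/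
theorem norm_fadingMoment_le (hα : 0 < α) (hμ : 0 < μ) (hφ : 0 < φ) (hS : 0 < S) (hhf : 0 < hf)
    {γ : ℝ} (hs1 : γ < φ) (hs2 : γ / α < μ) :
    ∃ C, 0 < C ∧ ∀ s : ℂ, s.re = γ →
      ‖(fadingScale α μ S hf : ℂ) ^ (-s) * φ / Real.Gamma μ *
        (Complex.Gamma (μ - s / α) / (φ - s))‖ * (1 + ‖s / 2‖) ≤ C * (1 + (α⁻¹ * s.im) ^ 2)⁻¹ := by
  obtain ⟨C₀, hC₀, hC⟩ := norm_Gamma_le_div (x := μ - γ / α) (by linarith)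
  set a := fadingScale α μ S hf with ha
  have ha0 : 0 < a := fadingScale_pos hμ hS hhf
  have hΓ := Real.Gamma_pos_of_pos hμ
  have hφγ : 0 < φ - γ := by linarith
  refine ⟨a ^ (-γ) * φ / Real.Gamma μ * C₀ * (1 + (1 + φ) / (φ - γ)), by positivity,
    fun s hs => ?_⟩
  have h1 := hC (μ - s / α) (by simp [Complex.div_ofReal_re, hs])
  have h2 : (μ - s / α : ℂ).im ^ 2 = (α⁻¹ * s.im) ^ 2 := by
    simp [Complex.div_ofReal_im]; ring
  rw [h2] at h1
  have h3 : φ - γ ≤ ‖(φ : ℂ) - s‖ := by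
    have := Complex.re_le_norm ((φ : ℂ) - s)
    simpa [hs] using this
  have h4 : 1 + ‖s / 2‖ ≤ ‖(φ : ℂ) - s‖ * (1 + (1 + φ) / (φ - γ)) := by
    have h5 : ‖s‖ ≤ ‖(φ : ℂ) - s‖ + φ := by
      have := norm_sub_le (φ : ℂ) ((φ : ℂ) - s)
      rw [sub_sub_cancel] at this
      simp [abs_of_pos hφ] at this
      linarith
    have h6 : 1 + φ ≤ ‖(φ : ℂ) - s‖ * ((1 + φ) / (φ - γ)) := by
      rw [← mul_div_assoc, le_div_iff₀ hφγ, mul_comm]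
      gcongr
    have h7 : ‖s / 2‖ ≤ ‖s‖ := by
      rw [norm_div]; simp
    linarith
  have h8 : 0 < ‖(φ : ℂ) - s‖ := by linarith
  rw [norm_mul, norm_div, norm_div, norm_mul, Complex.norm_cpow_eq_rpow_re_of_pos ha0]
  simp only [Complex.neg_re, hs, Complex.norm_real, Real.norm_eq_abs, abs_of_pos hφ, abs_of_pos hΓ]
  calc _ ≤ a ^ (-γ) * φ / Real.Gamma μ * ((C₀ / (1 + (α⁻¹ * s.im) ^ 2)) / ‖(φ : ℂ) - s‖) *
        (‖(φ : ℂ) - s‖ * (1 + (1 + φ) / (φ - γ))) := by gcongr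
    _ = _ := by field_simp

theorem integrable_inv_one_add_mul_sq (hα : 0 < α) :
    Integrable fun y : ℝ => (1 + (α⁻¹ * y) ^ 2)⁻¹ :=
  integrable_inv_one_add_sq.comp_mul_left' (inv_ne_zero hα.ne')

theorem verticalIntegrable_fadingMellin (hα : 0 < α) (hμ : 0 < μ) (hφ : 0 < φ) (hS : 0 < S)
    (hhf : 0 < hf) {γ : ℝ} {t : ℂ} (hs0 : 0 < γ) (hs1 : γ < φ) (hs2 : γ / α < μ)
    (hs3 : γ < -2 * t.re) :
    Complex.VerticalIntegrable (fadingMellin α μ φ S hf t) γ := by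
  obtain ⟨C, hC0, hC⟩ := norm_fadingMoment_le hα hμ hφ hS hhf hs1 hs2
  have ha0 : 0 < fadingScale α μ S hf := fadingScale_pos hμ hS hhf
  have hb : 0 < -t.re - γ / 2 := by linarith
  have hcont : Continuous fun y : ℝ => fadingMellin α μ φ S hf t (γ + y * Complex.I) := by
    unfold fadingMellin
    have hg1 : Continuous fun y : ℝ => Complex.Gamma (μ - (γ + y * Complex.I) / α) :=
      continuous_Gamma_comp (by fun_prop) fun y => by
        simpa [Complex.div_ofReal_re] using by linarith
    have hg2 : Continuous fun y : ℝ => Complex.Gamma ((γ + y * Complex.I) / 2) :=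
      continuous_Gamma_comp (by fun_prop) fun y => by simpa using hs0
    have hg3 : Continuous fun y : ℝ => Complex.Gamma (-t - (γ + y * Complex.I) / 2) :=
      continuous_Gamma_comp (by fun_prop) fun y => by simpa using by linarith
    have hp : Continuous fun y : ℝ =>
        (fadingScale α μ S hf : ℂ) ^ (-((γ : ℂ) + y * Complex.I)) :=
      Continuous.const_cpow (by fun_prop) (Or.inl (by exact_mod_cast ha0.ne'))
    have hd : Continuous fun y : ℝ => ((φ : ℂ) - (γ + y * Complex.I))⁻¹ :=
      Continuous.inv₀ (by fun_prop) fun y h => by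
        have := congrArg Complex.re h
        simp at this
        linarith
    simp only [div_eq_mul_inv] at *
    fun_prop
  refine Integrable.mono' ((integrable_inv_one_add_mul_sq hα).const_mul
    (C * (1 / 2 * (Real.Gamma (γ / 2) * Real.Gamma (-t.re - γ / 2) / ‖Complex.Gamma (-t)‖))))
    hcont.aestronglyMeasurable (ae_of_all _ fun y => ?_)
  have h1 := hC (γ + y * Complex.I) (by simp)
  have h2 := norm_Gamma_le (s := (γ + y * Complex.I) / 2) (by simpa using hs0)
  have h3 := norm_Gamma_le (s := -t - (γ + y * Complex.I) / 2) (by simpa using by linarith)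
  simp only [Complex.add_re, Complex.ofReal_re, Complex.mul_re, Complex.I_re, mul_zero,
    Complex.ofReal_im, Complex.I_im, mul_one, sub_self, add_zero, Complex.div_ofNat_re,
    Complex.sub_re, Complex.neg_re, Complex.add_im, Complex.mul_im, zero_add] at h1 h2 h3
  rw [fadingMellin, norm_mul]
  have h4 : ‖(1 / 2 : ℂ) * (Complex.Gamma ((γ + y * Complex.I) / 2) *
      Complex.Gamma (-t - (γ + y * Complex.I) / 2) / Complex.Gamma (-t))‖ ≤
      1 / 2 * (Real.Gamma (γ / 2) * Real.Gamma (-t.re - γ / 2) / ‖Complex.Gamma (-t)‖) := by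
    have : ‖(1 / 2 : ℂ)‖ = 1 / 2 := by simp
    rw [norm_mul, this, norm_div, norm_mul]
    have := (Real.Gamma_pos_of_pos (by linarith : 0 < γ / 2)).le
    gcongr
  have h5 : ‖(fadingScale α μ S hf : ℂ) ^ (-((γ : ℂ) + y * Complex.I)) * φ / Real.Gamma μ *
      (Complex.Gamma (μ - (γ + y * Complex.I) / α) / (φ - (γ + y * Complex.I)))‖ ≤
      C * (1 + (α⁻¹ * y) ^ 2)⁻¹ := by
    refine le_trans (le_mul_of_one_le_right (norm_nonneg _) ?_) h1
    have := norm_nonneg ((γ + y * Complex.I) / 2 : ℂ)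
    linarith
  calc _ ≤ _ := mul_le_mul h5 h4 (norm_nonneg _) (by positivity)
    _ = _ := by ring

theorem continuous_integral_one_add_sq_cpow (ν : Measure ℝ) [IsFiniteMeasure ν] {t : ℂ}
    (ht : t.re ≤ 0) : Continuous fun z : ℝ => ∫ x, (1 + ((z * x : ℝ) : ℂ) ^ 2) ^ t ∂ν := by
  refine continuous_of_dominated (bound := fun _ => 1) (fun z => ?_) (fun z => ?_)
    (integrable_const _) (ae_of_all _ fun x => ?_)
  · exact ((continuous_one_add_sq_cpow t).comp (by fun_prop : Continuous fun x : ℝ => z * x))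
      |>.aestronglyMeasurable
  · exact ae_of_all _ fun x => norm_one_add_sq_cpow_le_one _ ht
  · exact (continuous_one_add_sq_cpow t).comp (by fun_prop : Continuous fun z : ℝ => z * x)

theorem mellinInv_congr {f g : ℂ → ℂ} {γ : ℝ} (h : ∀ s : ℂ, s.re = γ → f s = g s) (z : ℝ) :
    mellinInv γ f z = mellinInv γ g z := by
  unfold mellinInv
  congr 2
  funext y
  rw [h _ (by simp)]

theorem mellinInv_fadingMellin [IsFiniteMeasure (fadingLaw α μ φ S hf)] (hα : 0 < α) (hμ : 0 < μ)
    (hφ : 0 < φ) (hS : 0 < S) (hhf : 0 < hf) {γ : ℝ} {t : ℂ} (hs0 : 0 < γ) (hs1 : γ < φ)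
    (hs2 : γ / α < μ) (hs3 : γ < -2 * t.re) {z : ℝ} (hz : 0 < z) :
    mellinInv γ (fadingMellin α μ φ S hf t) z =
      ∫ x, (1 + ((z * x : ℝ) : ℂ) ^ 2) ^ t ∂fadingLaw α μ φ S hf := by
  have hM : ∀ s : ℂ, s.re = γ → HasMellin (fun z : ℝ =>
      ∫ x, (1 + ((z * x : ℝ) : ℂ) ^ 2) ^ t ∂fadingLaw α μ φ S hf) s
      (fadingMellin α μ φ S hf t s) := fun s hs =>
    hasMellin_fading hα hμ hφ hS hhf (by rwa [hs]) (by rwa [hs]) (by rwa [hs]) (by rwa [hs])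
  rw [← mellinInv_congr (fun s hs => (hM s hs).2)]
  refine mellinInv_mellin_eq γ _ hz (hM γ (by simp)).1 ?_
    (continuous_integral_one_add_sq_cpow _ (by linarith)).continuousAt
  refine (verticalIntegrable_fadingMellin hα hμ hφ hS hhf hs0 hs1 hs2 hs3).congr
    (ae_of_all _ fun y => ?_)
  exact ((hM _ (by simp)).2).symm

/-- The Fox function in `psiFactor` is, up to a constant, a moment of the received power. -/
theorem psiFactor_eq [IsFiniteMeasure (fadingLaw α μ φ S hf)] (hα : 0 < α) (hμ : 0 < μ)
    (hφ : 0 < φ) (hS : 0 < S) (hhf : 0 < hf) {hl ρ : ℝ} (hhl : hl ≠ 0) (hρ : 0 < ρ) {t : ℂ}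
    (ht : t.re < 0) :
    ((φ / (2 * Real.Gamma μ) : ℝ) : ℂ) * psiFactor α μ φ S hf hl ρ t =
      ∫ x, (1 + (((ρ * |hl| ^ 2) ^ (1 / 2 : ℝ) * x : ℝ) : ℂ) ^ 2) ^ t
        ∂fadingLaw α μ φ S hf := by
  have hsep : ∀ γ : ℝ, FoxSeparates 1 3
      [(1 + t, 1 / 2), (1 - (μ : ℂ), 1 / α), (1 - (φ : ℂ), 1)]
      [(0, 1 / 2), (-(φ : ℂ), 1)] γ ↔ 0 < γ ∧ γ < -2 * t.re ∧ γ / α < μ ∧ γ < φ := by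
    intro γ
    simp only [FoxSeparates, List.take_succ_cons, List.take_zero, List.mem_cons, List.not_mem_nil,
      or_false, forall_eq_or_imp, forall_eq, Complex.zero_re, Complex.add_re, Complex.one_re,
      Complex.sub_re, Complex.ofReal_re, List.take_nil]
    have e : 1 / α * γ = γ / α := by ring
    rw [e]
    constructor
    · rintro ⟨h1, h2, h3, h4⟩
      exact ⟨by linarith, by linarith, by linarith, by linarith⟩
    · rintro ⟨h1, h2, h3, h4⟩
      exact ⟨by linarith, by linarith, by linarith, by linarith⟩
  have hex : ∃ γ : ℝ, FoxSeparates 1 3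
      [(1 + t, 1 / 2), (1 - (μ : ℂ), 1 / α), (1 - (φ : ℂ), 1)]
      [(0, 1 / 2), (-(φ : ℂ), 1)] γ := by
    have hm : 0 < min (-2 * t.re) (min (α * μ) φ) :=
      lt_min (by linarith) (lt_min (by positivity) hφ)
    refine ⟨min (-2 * t.re) (min (α * μ) φ) / 2, (hsep _).2 ⟨by linarith, ?_, ?_, ?_⟩⟩
    · have := min_le_left (-2 * t.re) (min (α * μ) φ)
      linarith
    · have := (min_le_right (-2 * t.re) (min (α * μ) φ)).trans (min_le_left _ _)
      rw [div_lt_iff₀ hα]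
      linarith
    · have := (min_le_right (-2 * t.re) (min (α * μ) φ)).trans (min_le_right _ _)
      linarith
  rw [psiFactor, foxH, dif_pos hex]
  set γ := hex.choose with hγdef
  obtain ⟨h1, h2, h3, h4⟩ := (hsep γ).1 hex.choose_spec
  have hb : 0 < ρ * |hl| ^ 2 := by have := abs_pos.2 hhl; positivity
  set b := (ρ * |hl| ^ 2) ^ (1 / 2 : ℝ) with hbdef
  have hb0 : 0 < b := by positivity
  have ha0 : 0 < fadingScale α μ S hf := fadingScale_pos hμ hS hhf
  have hΓ := Real.Gamma_pos_of_pos hμ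
  rw [← mellinInv_fadingMellin hα hμ hφ hS hhf h1 h4 h3 h2 hb0, ← fadingScale, mellinInv, mellinInv,
    mul_smul_comm, mul_smul_comm, ← integral_const_mul, ← integral_const_mul]
  congr 2
  funext y
  set s : ℂ := γ + y * Complex.I with hs
  have hφs : (φ : ℂ) - s ≠ 0 := fun h => by
    have := congrArg Complex.re h
    simp [hs] at this
    linarith
  have hΓ' : (Real.Gamma μ : ℂ) ≠ 0 := by exact_mod_cast hΓ.ne'
  have hΓs : Complex.Gamma ((φ : ℂ) - s) ≠ 0 :=
    Complex.Gamma_ne_zero_of_re_pos (by simp [hs]; linarith)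
  have hk : foxKernel 1 3
      [(1 + t, 1 / 2), (1 - (μ : ℂ), 1 / α), (1 - (φ : ℂ), 1)]
      [(0, 1 / 2), (-(φ : ℂ), 1)] s = Complex.Gamma (s / 2) *
        (Complex.Gamma (-t - s / 2) * Complex.Gamma (μ - s / α)) / (φ - s) := by
    simp only [foxKernel, List.take_succ_cons, List.take_zero, List.take_nil, List.map_cons,
      List.map_nil, List.prod_cons, List.prod_nil, List.drop_succ_cons, List.drop_zero, mul_one,
      one_mul]
    have e1 : (0 : ℂ) + ((1 / 2 : ℝ) : ℂ) * s = s / 2 := by push_cast; ring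
    have e2 : 1 - (1 + t) - ((1 / 2 : ℝ) : ℂ) * s = -t - s / 2 := by push_cast; ring
    have e3 : 1 - (1 - (μ : ℂ)) - ((1 / α : ℝ) : ℂ) * s = μ - s / α := by push_cast; ring
    have e4 : 1 - (1 - (φ : ℂ)) - ((1 : ℝ) : ℂ) * s = φ - s := by push_cast; ring
    have e5 : 1 - -(φ : ℂ) - ((1 : ℝ) : ℂ) * s = φ - s + 1 := by push_cast; ring
    rw [e1, e2, e3, e4, e5, Complex.Gamma_add_one _ hφs]
    field_simp
  rw [hk, fadingMellin, Complex.ofReal_mul, Complex.mul_cpow_ofReal_nonneg hb0.le ha0.le]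
  simp only [smul_eq_mul]
  push_cast
  ring

/-- The moments of the received power decay like a power of the imaginary part. -/
theorem norm_integral_fadingLaw_le [IsFiniteMeasure (fadingLaw α μ φ S hf)] (hα : 0 < α)
    (hμ : 0 < μ) (hφ : 0 < φ) (hS : 0 < S) (hhf : 0 < hf) {c : ℝ} (hc : c < 0) {z : ℝ}
    (hz : 0 < z) :
    ∃ C δ : ℝ, 0 < δ ∧ ∀ t : ℂ, t.re = c → 1 ≤ |t.im| →
      ‖∫ x, (1 + ((z * x : ℝ) : ℂ) ^ 2) ^ t ∂fadingLaw α μ φ S hf‖ ≤ C * |t.im| ^ (-δ) := by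
  obtain ⟨γ, h0, h1, h2, h3, h4⟩ : ∃ γ : ℝ, 0 < γ ∧ γ < φ ∧ γ / α < μ ∧ γ < -2 * c ∧ γ ≤ 2 := by
    have hm : 0 < min (min (-2 * c) 2) (min (α * μ) φ) :=
      lt_min (lt_min (by linarith) two_pos) (lt_min (by positivity) hφ)
    have m1 := (min_le_left (min (-2 * c) 2) (min (α * μ) φ)).trans (min_le_left _ _)
    have m2 := (min_le_left (min (-2 * c) 2) (min (α * μ) φ)).trans (min_le_right _ _)
    have m3 := (min_le_right (min (-2 * c) 2) (min (α * μ) φ)).trans (min_le_left _ _)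
    have m4 := (min_le_right (min (-2 * c) 2) (min (α * μ) φ)).trans (min_le_right _ _)
    refine ⟨min (min (-2 * c) 2) (min (α * μ) φ) / 2, by linarith, by linarith, ?_, by linarith,
      by linarith⟩
    rw [div_lt_iff₀ hα]
    linarith
  obtain ⟨C₁, hC₁, hM⟩ := norm_fadingMoment_le hα hμ hφ hS hhf h1 h2
  obtain ⟨C₂, hC₂, hB⟩ := norm_mellin_one_add_cpow_le (c := c) (g := γ / 2) (by linarith)
    (by linarith) (by linarith)
  set J := ∫ y : ℝ, (1 + (α⁻¹ * y) ^ 2)⁻¹ with hJ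
  refine ⟨1 / (2 * Real.pi) * (z ^ (-γ) * (C₁ * C₂ / 2) * J), γ / 2 / 2, by linarith,
    fun t ht hv => ?_⟩
  rw [← mellinInv_fadingMellin hα hμ hφ hS hhf h0 h1 h2 (by rwa [ht]) hz, mellinInv, norm_smul,
    Real.norm_of_nonneg (by positivity), mul_assoc (1 / (2 * Real.pi))]
  gcongr
  set D := |t.im| ^ (-(γ / 2 / 2)) with hD
  have hD0 : 0 ≤ D := by positivity
  have hint : Integrable fun y : ℝ => z ^ (-γ) * (C₁ * C₂ / 2) * D * (1 + (α⁻¹ * y) ^ 2)⁻¹ :=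
    (integrable_inv_one_add_mul_sq hα).const_mul _
  refine (norm_integral_le_of_norm_le hint (ae_of_all _ fun y => ?_)).trans_eq ?_
  · set s : ℂ := γ + y * Complex.I with hs
    have hsre : s.re = γ := by simp [hs]
    have hsim : s.im = y := by simp [hs]
    have k1 := hM s hsre
    have k2 := hB t (s / 2) ht hv (by simp [hsre])
    have k3 := (hasMellin_one_add_cpow (a := s / 2) (b := -t - s / 2) (by simp [hsre, h0])
      (by simp [hsre, ht]; linarith)).2
    rw [show -(s / 2 + (-t - s / 2)) = t by ring, show s / 2 + (-t - s / 2) = -t by ring] at k3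
    rw [k3] at k2
    rw [norm_smul, Complex.norm_cpow_eq_rpow_re_of_pos hz, Complex.neg_re, hsre, fadingMellin,
      norm_mul, norm_mul (1 / 2 : ℂ)]
    rw [hsim] at k1
    have : ‖(1 / 2 : ℂ)‖ = 1 / 2 := by simp
    rw [this]
    set A := ‖(fadingScale α μ S hf : ℂ) ^ (-s) * φ / Real.Gamma μ *
      (Complex.Gamma (μ - s / α) / (φ - s))‖ with hA
    calc _ ≤ z ^ (-γ) * (A * (1 / 2 * (C₂ * (1 + ‖s / 2‖) * D))) := by gcongr
      _ = z ^ (-γ) * (C₂ / 2) * D * (A * (1 + ‖s / 2‖)) := by ring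
      _ ≤ z ^ (-γ) * (C₂ / 2) * D * (C₁ * (1 + (α⁻¹ * y) ^ 2)⁻¹) := by gcongr
      _ = _ := by ring
  · rw [integral_const_mul]
    ring

end

/-! ### Inversion of the distribution function -/

theorem hasMellin_one_Ioi {t : ℂ} (ht : t.re < 0) :
    HasMellin ((Set.Ioi (1 : ℝ)).indicator fun _ => (1 : ℂ)) t (1 / (-t)) := by
  have e : ∀ y : ℝ, (y : ℂ) ^ (t - 1) • (Set.Ioi (1 : ℝ)).indicator (fun _ => (1 : ℂ)) y =
      (Set.Ioi (1 : ℝ)).indicator (fun y : ℝ => (y : ℂ) ^ (t - 1)) y := by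
    intro y
    by_cases h : y ∈ Set.Ioi (1 : ℝ) <;> simp [h]
  have h1 : (t - 1).re < -1 := by rw [Complex.sub_re, Complex.one_re]; linarith
  have hsub : Set.Ioi (0 : ℝ) ∩ Set.Ioi 1 = Set.Ioi 1 :=
    Set.inter_eq_right.2 (Set.Ioi_subset_Ioi zero_le_one)
  constructor
  · rw [MellinConvergent]
    simp_rw [e]
    rw [IntegrableOn, integrable_indicator_iff measurableSet_Ioi, IntegrableOn,
      Measure.restrict_restrict measurableSet_Ioi, Set.inter_comm, hsub]
    exact integrableOn_Ioi_cpow_of_lt h1 one_pos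
  · rw [mellin]
    simp_rw [e]
    rw [setIntegral_indicator measurableSet_Ioi, hsub, integral_Ioi_cpow_of_lt h1 one_pos]
    simp [div_neg, neg_div]

/-- Mellin inversion of the distribution function of a random variable `Z ≥ 1`. -/
theorem mellinInv_moment_eq_cdf {Ω : Type*} [MeasurableSpace Ω] {P : Measure Ω}
    [IsProbabilityMeasure P] {Z : Ω → ℝ} (hZ : Measurable Z) (hZ1 : ∀ᵐ ω ∂P, 1 ≤ Z ω) {c : ℝ}
    (hc : c < 0) {y : ℝ} (hy : 0 < y) (hatom : P {ω | Z ω = y} = 0)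
    (hvert : Complex.VerticalIntegrable (fun t => (∫ ω, (Z ω : ℂ) ^ t ∂P) / (-t)) c) :
    mellinInv c (fun t => (∫ ω, (Z ω : ℂ) ^ t ∂P) / (-t)) y = (P.real {ω | Z ω < y} : ℂ) := by
  set F : ℝ → ℂ := fun y => (P.real {ω | Z ω < y} : ℂ) with hF
  set k : ℝ → ℂ := (Set.Ioi (1 : ℝ)).indicator fun _ => (1 : ℂ) with hk
  have hFk : ∀ y, 0 < y → ∫ ω, (1 : ℂ) * k (y * (Z ω)⁻¹) ∂P = F y := by
    intro y hy
    have e : (fun ω => (1 : ℂ) * k (y * (Z ω)⁻¹)) =ᵐ[P]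
        {ω | Z ω < y}.indicator fun _ => (1 : ℂ) := by
      filter_upwards [hZ1] with ω hω
      have hω0 : 0 < Z ω := by linarith
      have hiff : y * (Z ω)⁻¹ ∈ Set.Ioi (1 : ℝ) ↔ ω ∈ {ω | Z ω < y} := by
        simp only [Set.mem_Ioi, Set.mem_ofPred_eq]
        rw [← div_eq_mul_inv, one_lt_div hω0]
      rw [one_mul, hk]
      by_cases h : ω ∈ {ω | Z ω < y}
      · rw [Set.indicator_of_mem h, Set.indicator_of_mem (hiff.2 h)]
      · rw [Set.indicator_of_notMem h, Set.indicator_of_notMem (mt hiff.1 h)]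
    rw [integral_congr_ae e, integral_indicator_const _ (measurableSet_lt hZ measurable_const)]
    simp [hF]
  have hM : ∀ t : ℂ, t.re = c → HasMellin F t ((∫ ω, (Z ω : ℂ) ^ t ∂P) / (-t)) := by
    intro t ht
    have eW : ∀ᵐ ω ∂P, (Z ω : ℂ) ^ t = (1 : ℂ) * (((Z ω)⁻¹ : ℝ) : ℂ) ^ (-t) := by
      filter_upwards [hZ1] with ω hω
      have hω0 : 0 < Z ω := by linarith
      rw [one_mul, Complex.ofReal_inv, Complex.cpow_neg, Complex.inv_cpow, inv_inv]
      rw [Complex.arg_ofReal_of_nonneg hω0.le]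
      exact Real.pi_pos.ne
    have hint : Integrable (fun ω => (Z ω : ℂ) ^ t) P := by
      refine Integrable.mono' (integrable_const 1) ?_ ?_
      · exact (by fun_prop : Measurable fun ω => (Z ω : ℂ) ^ t).aestronglyMeasurable
      · filter_upwards [hZ1] with ω hω
        rw [Complex.norm_cpow_eq_rpow_re_of_pos (by linarith)]
        exact Real.rpow_le_one_of_one_le_of_nonpos hω (by linarith)
    have key := hasMellin_integral_comp_mul (ν := P) (k := k)
      (measurable_const.indicator measurableSet_Ioi) (hasMellin_one_Ioi (ht ▸ hc))
      (w := fun _ => 1) (W := fun ω => (Z ω)⁻¹) aestronglyMeasurable_const hZ.inv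
      (hZ1.mono fun ω hω => by have : 0 < Z ω := by linarith
                               positivity)
      (hint.congr eW)
    rw [← integral_congr_ae eW, mul_one_div] at key
    have e : ∀ z ∈ Set.Ioi (0 : ℝ), (z : ℂ) ^ (t - 1) • ∫ ω, (1 : ℂ) * k (z * (Z ω)⁻¹) ∂P =
        (z : ℂ) ^ (t - 1) • F z := fun z hz => by rw [hFk z hz]
    constructor
    · exact key.1.congr_fun e measurableSet_Ioi
    · rw [mellin, ← setIntegral_congr_fun measurableSet_Ioi e]
      exact key.2
  rw [← mellinInv_congr (fun t ht => (hM t ht).2)]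
  refine mellinInv_mellin_eq c F hy (hM c (by simp)).1 ?_ ?_
  · exact hvert.congr (ae_of_all _ fun v => ((hM _ (by simp)).2).symm)
  · have hFi : F = fun y => ∫ ω, {ω | Z ω < y}.indicator (fun _ => (1 : ℂ)) ω ∂P := by
      funext y
      rw [integral_indicator_const _ (measurableSet_lt hZ measurable_const)]
      simp [hF]
    rw [hFi]
    refine continuousAt_of_dominated (bound := fun _ => 1) (Filter.Eventually.of_forall fun y => ?_)
      (Filter.Eventually.of_forall fun y => ae_of_all _ fun ω => ?_) (integrable_const _) ?_
    · exact (measurable_const.indicator (measurableSet_lt hZ measurable_const)).aestronglyMeasurable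
    · refine (norm_indicator_le_norm_self _ _).trans (by simp)
    · have hne : ∀ᵐ ω ∂P, Z ω ≠ y := by
        rw [ae_iff]
        simpa using hatom
      filter_upwards [hne] with ω hω
      rcases lt_or_gt_of_ne hω with h | h
      · refine ContinuousAt.congr (f := fun _ => (1 : ℂ)) continuousAt_const ?_
        filter_upwards [Ioi_mem_nhds h] with z hz
        rw [Set.indicator_of_mem (show ω ∈ {ω | Z ω < z} from hz)]
      · refine ContinuousAt.congr (f := fun _ => (0 : ℂ)) continuousAt_const ?_
        filter_upwards [Iio_mem_nhds h] with z hz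
        have hz : z < Z ω := hz
        have hnot : ω ∉ {ω | Z ω < z} := fun h' => lt_asymm hz h'
        rw [Set.indicator_of_notMem hnot]

/-- A product of bounded moments, one of which decays, gives an integrable Mellin transform. -/
theorem verticalIntegrable_prod_div {ι : Type*} {s : Finset ι} {i₀ : ι} (hi : i₀ ∈ s)
    {A : ι → ℂ → ℂ} {c : ℝ} (hc : c < 0) (hcont : ∀ i ∈ s, Continuous fun v : ℝ =>
      A i (c + v * Complex.I)) (hle : ∀ i ∈ s, ∀ t : ℂ, t.re = c → ‖A i t‖ ≤ 1) {C δ : ℝ}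
    (hδ : 0 < δ)
    (hdecay : ∀ t : ℂ, t.re = c → 1 ≤ |t.im| → ‖A i₀ t‖ ≤ C * |t.im| ^ (-δ)) :
    Complex.VerticalIntegrable (fun t => (∏ i ∈ s, A i t) / (-t)) c := by
  classical
  have hne : ∀ v : ℝ, -((c : ℂ) + v * Complex.I) ≠ 0 := fun v h => by
    have := congrArg Complex.re h
    simp at this
    linarith
  have hcm : Continuous fun v : ℝ =>
      (∏ i ∈ s, A i (c + v * Complex.I)) / (-((c : ℂ) + v * Complex.I)) :=
    (continuous_finsetProd s hcont).div (by fun_prop) hne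
  have hb : Integrable fun v : ℝ => (2 : ℝ) ^ (1 + δ) * (|C| + 1 / |c|) *
      (1 + ‖v‖) ^ (-(1 + δ)) := (integrable_one_add_norm (by simpa using hδ)).const_mul _
  refine hb.mono' hcm.aestronglyMeasurable (ae_of_all _ fun v => ?_)
  set t : ℂ := c + v * Complex.I with ht
  have hre : t.re = c := by simp [ht]
  have him : t.im = v := by simp [ht]
  have hprod : ‖∏ i ∈ s, A i t‖ ≤ ‖A i₀ t‖ := by
    rw [← Finset.mul_prod_erase s _ hi, norm_mul]
    refine mul_le_of_le_one_right (norm_nonneg _) ?_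
    rw [norm_prod]
    exact Finset.prod_le_one (fun _ _ => norm_nonneg _)
      fun i his => hle i (Finset.mem_of_mem_erase his) t hre
  have hc0 : 0 < |c| := abs_pos.2 hc.ne
  rw [norm_div, norm_neg, Real.norm_eq_abs]
  by_cases hv : 1 ≤ |v|
  · have hv0 : 0 < |v| := by linarith
    have h1 : |v| ≤ ‖t‖ := him ▸ Complex.abs_im_le_norm t
    have h2 := hdecay t hre (by rwa [him])
    rw [him] at h2
    have h3 : |v| ^ (-(1 + δ)) ≤ 2 ^ (1 + δ) * (1 + |v|) ^ (-(1 + δ)) := by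
      rw [Real.rpow_neg hv0.le, Real.rpow_neg (by linarith), ← div_eq_mul_inv,
        ← Real.div_rpow (by norm_num) (by linarith), ← Real.inv_rpow hv0.le]
      refine Real.rpow_le_rpow (by positivity) ?_ (by linarith)
      rw [inv_eq_one_div, div_le_div_iff₀ hv0 (by linarith)]
      linarith
    calc ‖∏ i ∈ s, A i t‖ / ‖t‖ ≤ (|C| * |v| ^ (-δ)) / |v| := by
          gcongr
          exact hprod.trans (h2.trans (by gcongr; exact le_abs_self C))
      _ = |C| * |v| ^ (-(1 + δ)) := by
          rw [show -(1 + δ) = -δ - 1 by ring, Real.rpow_sub_one hv0.ne']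
          ring
      _ ≤ (|C| + 1 / |c|) * (2 ^ (1 + δ) * (1 + |v|) ^ (-(1 + δ))) := by
          gcongr
          have : 0 < 1 / |c| := by positivity
          linarith
      _ = _ := by ring
  · have hv : |v| < 1 := not_le.1 hv
    have h1 : |c| ≤ ‖t‖ := hre ▸ Complex.abs_re_le_norm t
    have h3 : 1 ≤ 2 ^ (1 + δ) * (1 + |v|) ^ (-(1 + δ)) := by
      have hp : 0 < 1 + |v| := by positivity
      rw [Real.rpow_neg hp.le, ← div_eq_mul_inv, ← Real.div_rpow (by norm_num) hp.le]
      refine Real.one_le_rpow ?_ (by linarith)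
      rw [le_div_iff₀ hp]
      linarith
    calc ‖∏ i ∈ s, A i t‖ / ‖t‖ ≤ 1 / |c| := by
          gcongr
          exact hprod.trans (hle i₀ hi t hre)
      _ ≤ (|C| + 1 / |c|) * 1 := by
          have := abs_nonneg C
          linarith
      _ ≤ (|C| + 1 / |c|) * (2 ^ (1 + δ) * (1 + |v|) ^ (-(1 + δ))) := by gcongr
      _ = _ := by ring

/-! ### The distribution function after one round -/

theorem tendsto_rpow_mul_exp_neg_atTop (p : ℝ) :
    Filter.Tendsto (fun u : ℝ => u ^ p * Real.exp (-u)) Filter.atTop (nhds 0) := by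
  simpa using tendsto_rpow_mul_exp_neg_mul_atTop_nhds_zero p 1 one_pos

theorem upperGamma_add_one (p : ℝ) {x : ℝ} (hx : 0 < x) :
    upperGamma (p + 1) x = p * upperGamma p x + x ^ p * Real.exp (-x) := by
  have hd : ∀ u ∈ Set.Ici x, HasDerivAt (fun u : ℝ => -(u ^ p * Real.exp (-u)))
      (u ^ (p + 1 - 1) * Real.exp (-u) - p * (u ^ (p - 1) * Real.exp (-u))) u := by
    intro u hu
    have hu0 : 0 < u := lt_of_lt_of_le hx hu
    have h1 := Real.hasDerivAt_rpow_const (x := u) (p := p) (Or.inl hu0.ne')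
    have h2 : HasDerivAt (fun u : ℝ => Real.exp (-u)) (-Real.exp (-u)) u := by
      simpa using (hasDerivAt_neg u).exp
    refine (h1.mul h2).neg.congr_deriv ?_
    rw [add_sub_cancel_right]
    ring
  have h1 := integrableOn_upperGamma (p + 1) hx
  have h2 := (integrableOn_upperGamma p hx).const_mul p
  have key := integral_Ioi_of_hasDerivAt_of_tendsto' hd (h1.sub h2)
    (by simpa using (tendsto_rpow_mul_exp_neg_atTop p).neg)
  rw [integral_sub h1 h2, integral_const_mul] at key
  simp only [upperGamma]
  linarith

theorem tendsto_rpow_mul_upperGamma_atTop {q : ℝ} (hq : 0 ≤ q) (p : ℝ) :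
    Filter.Tendsto (fun τ : ℝ => τ ^ q * upperGamma p τ) Filter.atTop (nhds 0) := by
  have htail : Filter.Tendsto (fun τ : ℝ => upperGamma (p + q) τ) Filter.atTop (nhds 0) := by
    have h1 := intervalIntegral_tendsto_integral_Ioi (μ := volume) 1
      (integrableOn_upperGamma (p + q) one_pos) Filter.tendsto_id
    have h2 := h1.const_sub (upperGamma (p + q) 1)
    rw [show upperGamma (p + q) 1 - ∫ u in Set.Ioi (1 : ℝ), u ^ (p + q - 1) * Real.exp (-u) = 0
      from sub_self _] at h2
    refine h2.congr' ?_
    filter_upwards [Filter.eventually_ge_atTop 1] with τ hτ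
    have hi := integrableOn_upperGamma (p + q) one_pos
    rw [id, intervalIntegral.integral_of_le hτ, sub_eq_iff_eq_add', upperGamma, upperGamma,
      ← Set.Ioc_union_Ioi_eq_Ioi hτ]
    exact setIntegral_union Set.Ioc_disjoint_Ioi_same measurableSet_Ioi
      (hi.mono_set Set.Ioc_subset_Ioi_self) (hi.mono_set (Set.Ioi_subset_Ioi hτ))
  refine squeeze_zero' ?_ ?_ htail
  · filter_upwards [Filter.eventually_gt_atTop 0] with τ hτ
    exact mul_nonneg (by positivity) (upperGamma_nonneg _ hτ.le)
  · filter_upwards [Filter.eventually_gt_atTop 0] with τ hτ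
    rw [upperGamma, upperGamma, ← integral_const_mul]
    refine setIntegral_mono_on ((integrableOn_upperGamma p hτ).const_mul _)
      (integrableOn_upperGamma (p + q) hτ) measurableSet_Ioi fun u hu => ?_
    have hu' : τ < u := hu
    have hu0 : 0 < u := hτ.trans hu'
    rw [show p + q - 1 = q + (p - 1) by ring, Real.rpow_add hu0, mul_assoc]
    gcongr

theorem hasDerivAt_sum_upperGamma (q : ℝ) (k : ℕ) {τ : ℝ} (hτ : 0 < τ) :
    HasDerivAt (fun τ : ℝ => τ ^ q * ∑ n ∈ Finset.range (k + 1),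
        1 / (n.factorial : ℝ) * upperGamma (n - q) τ)
      (-(τ ^ (q - 1) * upperGamma ((k + 1 : ℕ) - q) τ / k.factorial)) τ := by
  have hterm : ∀ n : ℕ, HasDerivAt
      (fun τ : ℝ => τ ^ q * (1 / (n.factorial : ℝ) * upperGamma (n - q) τ))
      (1 / (n.factorial : ℝ) * (q * τ ^ (q - 1) * upperGamma (n - q) τ -
        τ ^ ((n : ℝ) - 1) * Real.exp (-τ))) τ := by
    intro n
    have h1 := Real.hasDerivAt_rpow_const (x := τ) (p := q) (Or.inl hτ.ne')
    refine (h1.mul ((hasDerivAt_upperGamma (n - q) hτ).const_mul _)).congr_deriv ?_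
    have : τ ^ ((n : ℝ) - 1) = τ ^ q * τ ^ (n - q - 1) := by
      rw [← Real.rpow_add hτ]; ring_nf
    rw [this]
    ring
  have hrec : ∀ n : ℕ, upperGamma ((n + 1 : ℕ) - q) τ =
      (n - q) * upperGamma (n - q) τ + τ ^ ((n : ℝ) - q) * Real.exp (-τ) := by
    intro n
    rw [← upperGamma_add_one _ hτ]
    push_cast
    ring_nf
  have hpow : ∀ n : ℕ, τ ^ ((n : ℝ) - 1) = τ ^ (q - 1) * τ ^ ((n : ℝ) - q) := by
    intro n
    rw [← Real.rpow_add hτ]; ring_nf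
  induction k with
  | zero =>
    simp only [zero_add, Finset.sum_range_one]
    refine (hterm 0).congr_deriv ?_
    have := hrec 0
    rw [zero_add] at this
    rw [this, hpow 0]
    simp
    ring
  | succ k ih =>
    have hsum : (fun τ : ℝ => τ ^ q * ∑ n ∈ Finset.range (k + 1 + 1),
        1 / (n.factorial : ℝ) * upperGamma (n - q) τ) = fun τ : ℝ =>
        (τ ^ q * ∑ n ∈ Finset.range (k + 1), 1 / (n.factorial : ℝ) * upperGamma (n - q) τ) +
        τ ^ q * (1 / ((k + 1).factorial : ℝ) * upperGamma ((k + 1 : ℕ) - q) τ) := by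
      funext τ
      rw [Finset.sum_range_succ, mul_add]
    rw [hsum]
    refine (ih.add (hterm (k + 1))).congr_deriv ?_
    rw [hrec (k + 1), hpow (k + 1), Nat.factorial_succ]
    have h1 : (k.factorial : ℝ) ≠ 0 := by exact_mod_cast k.factorial_ne_zero
    have h2 : (k + 1 : ℝ) ≠ 0 := by positivity
    push_cast
    field_simp
    ring

section
variable {α φ S hf : ℝ}

theorem integral_fadingPDF_Ioi (hα : 0 < α) (hφ : 0 < φ) (hS : 0 < S) (hhf : 0 < hf) (k : ℕ)
    {r : ℝ} (hr : 0 < r) :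
    ∫ x in Set.Ioi r, fadingPDF α (k + 1 : ℕ) φ S hf x =
      φ / α * (((r / fadingScale α (k + 1 : ℕ) S hf) ^ α) ^ (φ / α) *
        ∑ n ∈ Finset.range (k + 1), 1 / (n.factorial : ℝ) *
          upperGamma (n - φ / α) ((r / fadingScale α (k + 1 : ℕ) S hf) ^ α)) := by
  have hμ : (0 : ℝ) < (k + 1 : ℕ) := by positivity
  set a := fadingScale α (k + 1 : ℕ) S hf with ha
  have ha0 : 0 < a := fadingScale_pos hμ hS hhf
  set H : ℝ → ℝ := fun τ => τ ^ (φ / α) * ∑ n ∈ Finset.range (k + 1),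
    1 / (n.factorial : ℝ) * upperGamma (n - φ / α) τ with hH
  have hd : ∀ x ∈ Set.Ici r, HasDerivAt (fun x : ℝ => -(φ / α * H ((x / a) ^ α)))
      (fadingPDF α (k + 1 : ℕ) φ S hf x) x := by
    intro x hx
    have hx0 : 0 < x := lt_of_lt_of_le hr hx
    have hxa : 0 < x / a := by positivity
    have h1 : HasDerivAt (fun x : ℝ => (x / a) ^ α) (1 / a * α * (x / a) ^ (α - 1)) x :=
      ((hasDerivAt_id x).div_const a).rpow_const (Or.inl hxa.ne')
    have h2 := hasDerivAt_sum_upperGamma (φ / α) k (τ := (x / a) ^ α) (by positivity)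
    refine ((HasDerivAt.comp x h2 h1).const_mul (φ / α)).neg.congr_deriv ?_
    have hΓk : Real.Gamma ((k + 1 : ℕ) : ℝ) = k.factorial := by
      push_cast
      exact Real.Gamma_nat_eq_factorial k
    rw [fadingPDF_eq hα hμ hS hhf hx0, ← ha, hΓk]
    have h3 : x ^ (φ - 1) / a ^ φ =
        1 / a * (((x / a) ^ α) ^ (φ / α - 1) * (x / a) ^ (α - 1)) := by
      rw [← Real.rpow_mul hxa.le, ← Real.rpow_add hxa,
        show α * (φ / α - 1) + (α - 1) = φ - 1 by field_simp; ring,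
        Real.div_rpow hx0.le ha0.le, Real.rpow_sub_one ha0.ne']
      field_simp
    have h4 : φ / (a ^ φ * (k.factorial : ℝ)) * (x ^ (φ - 1) *
        upperGamma (((k + 1 : ℕ) : ℝ) - φ / α) ((x / a) ^ α)) = φ / (k.factorial : ℝ) *
        (x ^ (φ - 1) / a ^ φ) * upperGamma (((k + 1 : ℕ) : ℝ) - φ / α) ((x / a) ^ α) := by
      field_simp
    rw [h4, h3]
    field_simp
  have hlim : Filter.Tendsto (fun x : ℝ => -(φ / α * H ((x / a) ^ α))) Filter.atTop (nhds 0) := by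
    have h1 : Filter.Tendsto H Filter.atTop (nhds 0) := by
      have : Filter.Tendsto (fun τ : ℝ => ∑ n ∈ Finset.range (k + 1), 1 / (n.factorial : ℝ) *
          (τ ^ (φ / α) * upperGamma (n - φ / α) τ)) Filter.atTop
          (nhds (∑ n ∈ Finset.range (k + 1), 1 / (n.factorial : ℝ) * 0)) :=
        tendsto_finsetSum _ fun n _ =>
          (tendsto_rpow_mul_upperGamma_atTop (by positivity) _).const_mul _
      simp only [mul_zero, Finset.sum_const_zero] at this
      refine this.congr fun τ => ?_
      simp only [hH, Finset.mul_sum]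
      exact Finset.sum_congr rfl fun n _ => by ring
    have h2 : Filter.Tendsto (fun x : ℝ => (x / a) ^ α) Filter.atTop Filter.atTop :=
      (tendsto_rpow_atTop hα).comp (Filter.tendsto_id.atTop_div_const ha0)
    simpa using ((h1.comp h2).const_mul (φ / α)).neg
  rw [integral_Ioi_of_hasDerivAt_of_nonneg' hd (fun x hx =>
    fadingPDF_nonneg hμ hφ hS hhf (hr.trans hx)) hlim]
  ring

/-- The distribution function of the fading law, for integer `μ`. -/
theorem fadingLaw_real_Iio_eq_psiOne (hα : 0 < α) (hφ : 0 < φ) (hS : 0 < S)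
    (hhf : 0 < hf) {hl ρ : ℝ} (hhl : hl ≠ 0) (hρ : 0 < ρ) (k : ℕ)
    [IsProbabilityMeasure (fadingLaw α (k + 1 : ℕ) φ S hf)] {x : ℝ} (hx : 0 < x) :
    (fadingLaw α (k + 1 : ℕ) φ S hf).real
      (Set.Iio ((((2 : ℝ) ^ x - 1) / (ρ * |hl| ^ 2)) ^ (1 / 2 : ℝ))) =
      psiOne α (k + 1 : ℕ) φ S hf hl ρ x := by
  have hμ : (0 : ℝ) < (k + 1 : ℕ) := by positivity
  have hl0 : 0 < |hl| := abs_pos.2 hhl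
  have h2x : 0 < (2 : ℝ) ^ x - 1 := by
    have := Real.one_lt_rpow (by norm_num : (1 : ℝ) < 2) hx
    linarith
  set u := (2 : ℝ) ^ x - 1 with hu
  set r := (u / (ρ * |hl| ^ 2)) ^ (1 / 2 : ℝ) with hr
  have hr0 : 0 < r := by positivity
  have hrq : ∀ q : ℝ, r ^ q = u ^ (q / 2) / (|hl| ^ q * ρ ^ (q / 2)) := by
    intro q
    rw [hr, ← Real.rpow_mul (by positivity), Real.div_rpow h2x.le (by positivity),
      Real.mul_rpow hρ.le (by positivity), ← Real.rpow_natCast, ← Real.rpow_mul hl0.le]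
    ring_nf
  have hcompl : (Set.Iio r)ᶜ = Set.Ici r := Set.compl_Iio
  have hmeas : (fadingLaw α (k + 1 : ℕ) φ S hf).real (Set.Ici r) =
      ∫ y in Set.Ioi r, fadingPDF α (k + 1 : ℕ) φ S hf y := by
    have hnn : ∀ᵐ y ∂(volume.restrict (Set.Ioi r)), 0 ≤ fadingPDF α (k + 1 : ℕ) φ S hf y :=
      (ae_restrict_mem measurableSet_Ioi).mono fun y hy =>
        fadingPDF_nonneg hμ hφ hS hhf (hr0.trans hy)
    have hm : AEStronglyMeasurable (fadingPDF α (k + 1 : ℕ) φ S hf)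
        (volume.restrict (Set.Ioi r)) :=
      ((continuousOn_fadingPDF hμ hS hhf).mono
        (Set.Ioi_subset_Ioi hr0.le)).aestronglyMeasurable measurableSet_Ioi
    rw [integral_eq_lintegral_of_nonneg_ae hnn hm, measureReal_def, fadingLaw,
      withDensity_apply _ measurableSet_Ici, Measure.restrict_restrict measurableSet_Ici,
      Set.inter_eq_left.2 (Set.Ici_subset_Ioi.2 hr0), Measure.restrict_congr_set Ioi_ae_eq_Ici]
  have h1 := probReal_compl_eq_one_sub (μ := fadingLaw α (k + 1 : ℕ) φ S hf)
    (measurableSet_Iio (a := r))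
  rw [hcompl, hmeas, integral_fadingPDF_Ioi hα hφ hS hhf k hr0] at h1
  have ha0 : 0 < fadingScale α (k + 1 : ℕ) S hf := fadingScale_pos hμ hS hhf
  have e1 : (r / fadingScale α (k + 1 : ℕ) S hf) ^ α = ((k + 1 : ℕ) : ℝ) * u ^ (α / 2) /
      (S ^ α * |hl| ^ α * hf ^ α * ρ ^ (α / 2)) := by
    rw [div_fadingScale_rpow hα hμ hS hhf hr0.le, hrq]
    field_simp
  have e2 : ((r / fadingScale α (k + 1 : ℕ) S hf) ^ α) ^ (φ / α) =
      ((k + 1 : ℕ) : ℝ) ^ (φ / α) * u ^ (φ / 2) /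
      (S ^ φ * |hl| ^ φ * hf ^ φ * ρ ^ (φ / 2)) := by
    rw [← Real.rpow_mul (by positivity), mul_div_cancel₀ _ hα.ne', Real.div_rpow hr0.le ha0.le,
      fadingScale_rpow hα hμ hS hhf, hrq]
    field_simp
  rw [e2, e1] at h1
  have e3 : ∀ n : ℕ, (α * n - φ) / α = n - φ / α := fun n => by field_simp
  rw [psiOne, Nat.floor_natCast, ← hu]
  simp_rw [e3]
  rw [eq_sub_iff_add_eq, add_comm, ← eq_sub_iff_add_eq, ← h1]
  field_simp

end

/-! ### Accumulated mutual information at one receiver -/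

theorem ProbabilityTheory.iIndepFun.indep_iSup_comap {Ω ι : Type*} [MeasurableSpace Ω]
    {P : Measure Ω} {X : ι → Ω → ℝ} (hX : iIndepFun X P) (hXm : ∀ i, Measurable (X i)) {S T : Set ι}
    (hST : Disjoint S T) :
    Indep (⨆ i ∈ S, MeasurableSpace.comap (X i) inferInstance)
      (⨆ i ∈ T, MeasurableSpace.comap (X i) inferInstance) P :=
  indep_iSup_of_disjoint (fun i => (hXm i).comap_le) hX hST

theorem measurable_iSup_comap {Ω ι : Type*} {X : ι → Ω → ℝ} {S : Set ι} {i : ι} (hi : i ∈ S) :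
    Measurable[⨆ i ∈ S, MeasurableSpace.comap (X i) inferInstance] (X i) :=
  (comap_measurable (X i)).mono
    (le_iSup₂_of_le (f := fun i (_ : i ∈ S) => MeasurableSpace.comap (X i) inferInstance) i hi
      le_rfl) le_rfl

theorem measurable_mutualInfo {Ω : Type*} [MeasurableSpace Ω] {ρ : ℕ → ℝ} {hl : ℝ}
    {h : ℕ → Ω → ℂ} {m : ℕ} (hh : ∀ k ∈ Finset.Icc 1 m, Measurable fun ω => ‖h k ω‖) :
    Measurable (mutualInfo ρ hl h m) := by
  unfold mutualInfo
  refine Finset.measurable_fun_sum _ fun k hk => ?_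
  have := hh k hk
  unfold Real.logb
  fun_prop

theorem mutualInfo_zero {Ω : Type*} (ρ : ℕ → ℝ) (hl : ℝ) (h : ℕ → Ω → ℂ) (ω : Ω) :
    mutualInfo ρ hl h 0 ω = 0 := by
  simp [mutualInfo]

theorem mutualInfo_succ {Ω : Type*} (ρ : ℕ → ℝ) (hl : ℝ) (h : ℕ → Ω → ℂ) (m : ℕ) (ω : Ω) :
    mutualInfo ρ hl h (m + 1) ω = mutualInfo ρ hl h m ω +
      Real.logb 2 (1 + ρ (m + 1) * |hl| ^ 2 * ‖h (m + 1) ω‖ ^ 2) := by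
  rw [mutualInfo, mutualInfo, Finset.sum_Icc_succ_top (by omega)]

theorem mutualInfo_mono {Ω : Type*} {ρ : ℕ → ℝ} {hl : ℝ} {h : ℕ → Ω → ℂ} {M : ℕ}
    (hρ : ∀ m ∈ Finset.Icc 1 M, 0 < ρ m) {j m : ℕ} (hjm : j ≤ m) (hmM : m ≤ M) (ω : Ω) :
    mutualInfo ρ hl h j ω ≤ mutualInfo ρ hl h m ω := by
  refine Finset.sum_le_sum_of_subset_of_nonneg (Finset.Icc_subset_Icc le_rfl hjm)
    fun k hk _ => Real.logb_nonneg one_lt_two ?_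
  have hk := Finset.mem_Icc.1 hk
  have := hρ k (Finset.mem_Icc.2 ⟨hk.1, hk.2.trans hmM⟩)
  have : 0 ≤ ρ k * |hl| ^ 2 * ‖h k ω‖ ^ 2 := by positivity
  linarith

theorem measure_add_comp_eq_zero {Ω : Type*} [MeasurableSpace Ω] {P : Measure Ω}
    [IsProbabilityMeasure P] {X Y : Ω → ℝ} (hX : Measurable X) (hY : Measurable Y)
    (hXY : IndepFun X Y P) {g : ℝ → ℝ} (hg : Measurable g)
    (hnull : ∀ d, P.map Y {y | g y = d} = 0) (x : ℝ) : P {ω | X ω + g (Y ω) = x} = 0 := by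
  have hs : MeasurableSet {p : ℝ × ℝ | p.1 + g p.2 = x} :=
    measurableSet_eq_fun (by fun_prop) measurable_const
  have h1 := (indepFun_iff_map_prod_eq_prod_map_map hX.aemeasurable hY.aemeasurable).1 hXY
  have : IsProbabilityMeasure (P.map Y) := Measure.isProbabilityMeasure_map hY.aemeasurable
  have h2 : P {ω | X ω + g (Y ω) = x} =
      (P.map fun ω => (X ω, Y ω)) {p : ℝ × ℝ | p.1 + g p.2 = x} := by
    rw [Measure.map_apply (hX.prodMk hY) hs]
    rfl
  rw [h2, h1, Measure.measure_prod_null hs]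
  refine ae_of_all _ fun a => ?_
  have : Prod.mk a ⁻¹' {p : ℝ × ℝ | p.1 + g p.2 = x} = {y | g y = x - a} := by
    ext y
    simp only [Set.mem_preimage, Set.mem_ofPred_eq]
    constructor <;> intro h <;> linarith
  simp only [Pi.zero_apply]
  rw [this, hnull]

theorem fadingLaw_logb_level_eq_zero {α μ φ S hf b : ℝ} (hb : 0 < b) (d : ℝ) :
    fadingLaw α μ φ S hf {y | Real.logb 2 (1 + b * y ^ 2) = d} = 0 := by
  have hsub : ({y : ℝ | Real.logb 2 (1 + b * y ^ 2) = d} ∩ Set.Ioi 0).Subsingleton := by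
    rintro y ⟨hy, hy0⟩ z ⟨hz, hz0⟩
    have hy0 : 0 < y := hy0
    have hz0 : 0 < z := hz0
    have h1 : 1 + b * y ^ 2 = 1 + b * z ^ 2 :=
      Real.logb_injOn_pos one_lt_two (Set.mem_Ioi.2 (by positivity)) (Set.mem_Ioi.2 (by positivity))
        (Eq.trans hy hz.symm)
    have h2 : y ^ 2 = z ^ 2 := mul_left_cancel₀ hb.ne' (by linarith)
    exact (pow_left_inj₀ hy0.le hz0.le two_ne_zero).1 h2
  have h0 : fadingLaw α μ φ S hf (Set.Ioi 0)ᶜ = 0 := ae_pos_fadingLaw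
  refine measure_mono_null (t := ({y : ℝ | Real.logb 2 (1 + b * y ^ 2) = d} ∩ Set.Ioi 0) ∪
    (Set.Ioi 0)ᶜ) (fun y hy => ?_) (measure_union_null (hsub.measure_zero _) h0)
  by_cases h : y ∈ Set.Ioi (0 : ℝ)
  · exact Or.inl ⟨hy, h⟩
  · exact Or.inr h

theorem continuous_integral_cpow_line (ν : Measure ℝ) [IsFiniteMeasure ν] (b : ℝ) {c : ℝ}
    (hc : c ≤ 0) : Continuous fun v : ℝ =>
      ∫ x, (1 + ((b * x : ℝ) : ℂ) ^ 2) ^ ((c : ℂ) + v * Complex.I) ∂ν := by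
  refine continuous_of_dominated (bound := fun _ => 1) (fun v => ?_) (fun v => ?_)
    (integrable_const _) (ae_of_all _ fun x => ?_)
  · exact ((continuous_one_add_sq_cpow _).comp (by fun_prop : Continuous fun x : ℝ => b * x))
      |>.aestronglyMeasurable
  · exact ae_of_all _ fun x => norm_one_add_sq_cpow_le_one _ (by simpa using hc)
  · refine Continuous.const_cpow (by fun_prop) (Or.inl ?_)
    rw [← Complex.ofReal_pow]
    have : 0 < 1 + (b * x) ^ 2 := by positivity
    exact_mod_cast this.ne'

section
variable {Ω : Type*} [MeasurableSpace Ω] {P : Measure Ω}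
  {α μ φ S hf hl : ℝ} {ρ : ℕ → ℝ} {h : ℕ → Ω → ℂ} {m : ℕ}

theorem isProbabilityMeasure_fadingLaw [IsProbabilityMeasure P] {X : Ω → ℝ} (hX : Measurable X)
    (hlaw : P.map X = fadingLaw α μ φ S hf) : IsProbabilityMeasure (fadingLaw α μ φ S hf) :=
  hlaw ▸ Measure.isProbabilityMeasure_map hX.aemeasurable

theorem measure_mutualInfo_eq_zero [IsProbabilityMeasure P] (hhl : hl ≠ 0) (hm : 1 ≤ m)
    (hρ : ∀ k ∈ Finset.Icc 1 m, 0 < ρ k)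
    (hmeas : ∀ k ∈ Finset.Icc 1 m, Measurable fun ω => ‖h k ω‖)
    (hindep : iIndepFun (fun (k : Finset.Icc 1 m) ω => ‖h k ω‖) P)
    (hlaw : ∀ k ∈ Finset.Icc 1 m, P.map (fun ω => ‖h k ω‖) = fadingLaw α μ φ S hf) (x : ℝ) :
    P {ω | mutualInfo ρ hl h m ω = x} = 0 := by
  obtain ⟨n, rfl⟩ : ∃ n, m = n + 1 := ⟨m - 1, by omega⟩
  have hl0 : 0 < |hl| := abs_pos.2 hhl
  have hlast : n + 1 ∈ Finset.Icc 1 (n + 1) := Finset.mem_Icc.2 ⟨by omega, le_rfl⟩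
  have hρn := hρ _ hlast
  have hsub : ∀ k ∈ Finset.Icc 1 n, k ∈ Finset.Icc 1 (n + 1) := fun k hk =>
    Finset.Icc_subset_Icc le_rfl (Nat.le_succ n) hk
  simp_rw [mutualInfo_succ]
  refine measure_add_comp_eq_zero (Y := fun ω => ‖h (n + 1) ω‖)
    (g := fun y => Real.logb 2 (1 + ρ (n + 1) * |hl| ^ 2 * y ^ 2))
    (measurable_mutualInfo fun k hk => hmeas k (hsub k hk)) (hmeas _ hlast) ?_
    (by unfold Real.logb; fun_prop) (fun d => ?_) x
  · have hI := hindep.indep_iSup_comap (fun k => hmeas k k.2)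
      (S := {k | (k : ℕ) ≠ n + 1}) (T := {k | (k : ℕ) = n + 1})
      (Set.disjoint_left.2 fun k hk hk' => hk hk')
    have h1 : Measurable[⨆ i ∈ {k : Finset.Icc 1 (n + 1) | (k : ℕ) ≠ n + 1},
        MeasurableSpace.comap (fun ω => ‖h i ω‖) inferInstance] (mutualInfo ρ hl h n) := by
      refine @measurable_mutualInfo Ω (_) ρ hl h n fun k hk => ?_
      exact measurable_iSup_comap (X := fun (k : Finset.Icc 1 (n + 1)) ω => ‖h k ω‖)
        (i := ⟨k, hsub k hk⟩) (by have := Finset.mem_Icc.1 hk; simp; omega)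
    have h2 : Measurable[⨆ i ∈ {k : Finset.Icc 1 (n + 1) | (k : ℕ) = n + 1},
        MeasurableSpace.comap (fun ω => ‖h i ω‖) inferInstance] (fun ω => ‖h (n + 1) ω‖) :=
      measurable_iSup_comap (X := fun (k : Finset.Icc 1 (n + 1)) ω => ‖h k ω‖)
        (i := ⟨n + 1, hlast⟩) rfl
    exact (IndepFun_iff_Indep _ _ _).2
      (indep_of_indep_of_le_left (indep_of_indep_of_le_right hI h2.comap_le) h1.comap_le)
  · rw [hlaw _ hlast]
    exact fadingLaw_logb_level_eq_zero (by positivity) d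

theorem integral_two_rpow_mutualInfo_cpow (hhl : hl ≠ 0) (hρ : ∀ k ∈ Finset.Icc 1 m, 0 < ρ k)
    (hmeas : ∀ k ∈ Finset.Icc 1 m, Measurable fun ω => ‖h k ω‖)
    (hindep : iIndepFun (fun (k : Finset.Icc 1 m) ω => ‖h k ω‖) P)
    (hlaw : ∀ k ∈ Finset.Icc 1 m, P.map (fun ω => ‖h k ω‖) = fadingLaw α μ φ S hf) (t : ℂ) :
    ∫ ω, (((2 : ℝ) ^ mutualInfo ρ hl h m ω : ℝ) : ℂ) ^ t ∂P =
      ∏ k ∈ Finset.Icc 1 m,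
        ∫ x, (1 + (((ρ k * |hl| ^ 2) ^ (1 / 2 : ℝ) * x : ℝ) : ℂ) ^ 2) ^ t
          ∂fadingLaw α μ φ S hf := by
  have hl0 : 0 < |hl| := abs_pos.2 hhl
  set f : ℕ → ℝ → ℂ := fun k x => (1 + (((ρ k * |hl| ^ 2) ^ (1 / 2 : ℝ) * x : ℝ) : ℂ) ^ 2) ^ t
    with hf'
  have hfc : ∀ k, Continuous (f k) := fun k =>
    (continuous_one_add_sq_cpow t).comp (by fun_prop : Continuous fun x : ℝ =>
      (ρ k * |hl| ^ 2) ^ (1 / 2 : ℝ) * x)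
  have hprod : ∀ ω, (((2 : ℝ) ^ mutualInfo ρ hl h m ω : ℝ) : ℂ) ^ t =
      ∏ k : Finset.Icc 1 m, f k ‖h k ω‖ := by
    intro ω
    have e1 : (((2 : ℝ) ^ mutualInfo ρ hl h m ω : ℝ) : ℂ) ^ t =
        Complex.exp (((mutualInfo ρ hl h m ω * Real.log 2 : ℝ) : ℂ) * t) := by
      rw [Complex.cpow_def_of_ne_zero (by
        exact_mod_cast (Real.rpow_pos_of_pos two_pos (mutualInfo ρ hl h m ω)).ne'),
        ← Complex.ofReal_log (by positivity), Real.log_rpow two_pos]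
    rw [e1, mutualInfo, Finset.sum_mul, Complex.ofReal_sum, Finset.sum_mul, Complex.exp_sum,
      Finset.prod_coe_sort (Finset.Icc 1 m) fun k => f k ‖h k ω‖]
    refine Finset.prod_congr rfl fun k hk => ?_
    have hρk := hρ k hk
    have hpos : 0 < 1 + ρ k * |hl| ^ 2 * ‖h k ω‖ ^ 2 := by positivity
    have hlog2 : Real.log 2 ≠ 0 := (Real.log_pos one_lt_two).ne'
    have e2 : ((ρ k * |hl| ^ 2) ^ (1 / 2 : ℝ) * ‖h k ω‖) ^ 2 = ρ k * |hl| ^ 2 * ‖h k ω‖ ^ 2 := by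
      rw [mul_pow, ← Real.sqrt_eq_rpow, Real.sq_sqrt (by positivity)]
    rw [hf']
    simp only
    rw [← Complex.ofReal_pow, e2, ← Complex.ofReal_one, ← Complex.ofReal_add,
      Complex.cpow_def_of_ne_zero (by exact_mod_cast hpos.ne'), ← Complex.ofReal_log hpos.le,
      Real.logb, div_mul_cancel₀ _ hlog2]
  simp_rw [hprod]
  rw [hindep.integral_fun_prod_comp (f := fun (k : Finset.Icc 1 m) => f k)
    (fun k => (hmeas k k.2).aemeasurable) (fun k => (hfc k).aestronglyMeasurable)]
  rw [Finset.prod_coe_sort (Finset.Icc 1 m) fun k => ∫ ω, f k ‖h k ω‖ ∂P]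
  refine Finset.prod_congr rfl fun k hk => ?_
  rw [← hlaw k hk, integral_map (hmeas k hk).aemeasurable (hfc k).aestronglyMeasurable]

/-- The contour integral `psiContour` is the distribution function of the accumulated mutual
information. -/
theorem cdf_mutualInfo_eq_psiContour [IsProbabilityMeasure P] (hα : 0 < α) (hμ : 0 < μ) (hφ : 0 < φ) (hS : 0 < S)
    (hhf : 0 < hf) (hhl : hl ≠ 0) (hm : 1 ≤ m) (hρ : ∀ k ∈ Finset.Icc 1 m, 0 < ρ k)
    (hmeas : ∀ k ∈ Finset.Icc 1 m, Measurable fun ω => ‖h k ω‖)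
    (hindep : iIndepFun (fun (k : Finset.Icc 1 m) ω => ‖h k ω‖) P)
    (hlaw : ∀ k ∈ Finset.Icc 1 m, P.map (fun ω => ‖h k ω‖) = fadingLaw α μ φ S hf)
    {c : ℝ} (hc : c < 0) (x : ℝ) :
    (P.real {ω | mutualInfo ρ hl h m ω < x} : ℂ) = psiContour α μ φ S hf hl ρ c m x := by
  have hl0 : 0 < |hl| := abs_pos.2 hhl
  have hfirst : 1 ∈ Finset.Icc 1 m := Finset.mem_Icc.2 ⟨le_rfl, hm⟩
  have := isProbabilityMeasure_fadingLaw (hmeas 1 hfirst) (hlaw 1 hfirst)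
  set A : ℕ → ℂ → ℂ := fun k t => ∫ x, (1 + (((ρ k * |hl| ^ 2) ^ (1 / 2 : ℝ) * x : ℝ) : ℂ) ^ 2) ^ t
    ∂fadingLaw α μ φ S hf with hA
  have hmom : ∀ t, ∫ ω, (((2 : ℝ) ^ mutualInfo ρ hl h m ω : ℝ) : ℂ) ^ t ∂P =
      ∏ k ∈ Finset.Icc 1 m, A k t := integral_two_rpow_mutualInfo_cpow hhl hρ hmeas hindep hlaw
  have hIm := measurable_mutualInfo (ρ := ρ) (hl := hl) hmeas
  have hρ1 := hρ 1 hfirst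
  obtain ⟨C, δ, hδ, hdecay⟩ := norm_integral_fadingLaw_le (α := α) (μ := μ) (φ := φ) (S := S)
    (hf := hf) hα hμ hφ hS hhf hc (z := (ρ 1 * |hl| ^ 2) ^ (1 / 2 : ℝ)) (by positivity)
  have hvert := verticalIntegrable_prod_div (s := Finset.Icc 1 m) hfirst (A := A) hc
    (fun k _ => continuous_integral_cpow_line _ _ hc.le)
    (fun k _ t ht => by
      refine (norm_integral_le_of_norm_le_const (C := 1) (ae_of_all _ fun x =>
        norm_one_add_sq_cpow_le_one _ (by linarith))).trans ?_
      simp) hδ hdecay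
  have key := mellinInv_moment_eq_cdf (P := P) (Z := fun ω => (2 : ℝ) ^ mutualInfo ρ hl h m ω)
    (by fun_prop) (ae_of_all _ fun ω => Real.one_le_rpow one_le_two (by
      have := mutualInfo_mono (hl := hl) (h := h) hρ (Nat.zero_le m) le_rfl ω
      rwa [mutualInfo_zero] at this)) hc (y := (2 : ℝ) ^ x) (by positivity)
    (by
      rw [← measure_mutualInfo_eq_zero (P := P) hhl hm hρ hmeas hindep hlaw x]
      congr 1
      ext ω
      exact Real.rpow_right_inj two_pos (by norm_num))
    (by simp_rw [hmom]; exact hvert)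
  simp_rw [hmom] at key
  have hset : {ω | (2 : ℝ) ^ mutualInfo ρ hl h m ω < (2 : ℝ) ^ x} =
      {ω | mutualInfo ρ hl h m ω < x} := by
    ext ω
    exact Real.rpow_lt_rpow_left_iff one_lt_two
  rw [hset] at key
  rw [← key, psiContour, mellinInv, Complex.real_smul, ← integral_const_mul, ← integral_const_mul]
  congr 1
  funext v
  set t : ℂ := c + v * Complex.I with ht
  have hfac : ∏ k ∈ Finset.Icc 1 m, A k t = ((φ / (2 * Real.Gamma μ) : ℝ) : ℂ) ^ m *
      ∏ k ∈ Finset.Icc 1 m, psiFactor α μ φ S hf hl (ρ k) t := by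
    have : ((φ / (2 * Real.Gamma μ) : ℝ) : ℂ) ^ m =
        ∏ _k ∈ Finset.Icc 1 m, ((φ / (2 * Real.Gamma μ) : ℝ) : ℂ) := by
      rw [Finset.prod_const, Nat.card_Icc, Nat.add_sub_cancel]
    rw [this, ← Finset.prod_mul_distrib]
    exact Finset.prod_congr rfl fun k hk =>
      (psiFactor_eq hα hμ hφ hS hhf hhl (hρ k hk) (by simpa [ht] using hc)).symm
  have hexp : (((2 : ℝ) ^ x : ℝ) : ℂ) ^ (-t) = Complex.exp (-x * t * Real.log 2) := by
    rw [Complex.cpow_def_of_ne_zero (by exact_mod_cast (Real.rpow_pos_of_pos two_pos x).ne'),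
      ← Complex.ofReal_log (by positivity), Real.log_rpow two_pos]
    push_cast
    ring_nf
  have hI : Complex.I ≠ 0 := Complex.I_ne_zero
  have hπ : (Real.pi : ℂ) ≠ 0 := by exact_mod_cast Real.pi_ne_zero
  rw [hexp, hfac, smul_eq_mul]
  push_cast
  field_simp

/-- The closed form for one round. -/
theorem cdf_mutualInfo_one_eq_psiOne [IsProbabilityMeasure P] (hα : 0 < α) (hμ : 0 < μ) (hφ : 0 < φ) (hS : 0 < S)
    (hhf : 0 < hf) (hhl : hl ≠ 0) (hρ : 0 < ρ 1) (hmeas : Measurable fun ω => ‖h 1 ω‖)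
    (hlaw : P.map (fun ω => ‖h 1 ω‖) = fadingLaw α μ φ S hf) (hint : ∃ k : ℕ, μ = k) {x : ℝ}
    (hx : 0 < x) :
    P.real {ω | mutualInfo ρ hl h 1 ω < x} = psiOne α μ φ S hf hl (ρ 1) x := by
  obtain ⟨k, rfl⟩ := hint
  obtain ⟨n, rfl⟩ : ∃ n, k = n + 1 :=
    ⟨k - 1, by have : 0 < k := by exact_mod_cast hμ
               omega⟩
  have := isProbabilityMeasure_fadingLaw hmeas hlaw
  have hl0 : 0 < |hl| := abs_pos.2 hhl
  rw [← fadingLaw_real_Iio_eq_psiOne hα hφ hS hhf hhl hρ n hx, ← hlaw,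
    map_measureReal_apply hmeas measurableSet_Iio]
  congr 1
  ext ω
  have hpos : 0 < 1 + ρ 1 * |hl| ^ 2 * ‖h 1 ω‖ ^ 2 := by positivity
  have h2x : 0 < (2 : ℝ) ^ x - 1 := by
    have := Real.one_lt_rpow (by norm_num : (1 : ℝ) < 2) hx
    linarith
  simp only [mutualInfo, Finset.Icc_self, Finset.sum_singleton, Set.mem_ofPred_eq,
    Set.mem_preimage, Set.mem_Iio]
  rw [Real.logb_lt_iff_lt_rpow one_lt_two hpos, ← Real.sqrt_eq_rpow,
    Real.lt_sqrt (norm_nonneg _), lt_div_iff₀ (by positivity)]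
  constructor <;> intro h <;> linarith

end

/-! ### The number of rounds and the secrecy outage probability -/

section
variable {Ω : Type*} {M : ℕ} {R₀ : ℝ} {J : ℕ → Ω → ℝ}

theorem numRounds_mem (hM : 1 ≤ M) (ω : Ω) :
    numRounds M R₀ J ω ∈ {m : ℕ | 1 ≤ m ∧ (R₀ ≤ J m ω ∨ m = M)} :=
  Nat.sInf_mem ⟨M, hM, Or.inr rfl⟩

theorem numRounds_mem_Icc (hM : 1 ≤ M) (ω : Ω) : numRounds M R₀ J ω ∈ Finset.Icc 1 M :=
  Finset.mem_Icc.2 ⟨(numRounds_mem hM ω).1, Nat.sInf_le ⟨hM, Or.inr rfl⟩⟩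

theorem numRounds_eq_iff (h0 : ∀ ω, J 0 ω < R₀)
    (hmono : ∀ {j m : ℕ}, j ≤ m → m ≤ M → ∀ ω, J j ω ≤ J m ω) {m : ℕ}
    (hm : m ∈ Finset.Icc 1 M) (ω : Ω) :
    numRounds M R₀ J ω = m ↔ J (m - 1) ω < R₀ ∧ (R₀ ≤ J m ω ∨ m = M) := by
  obtain ⟨hm1, hmM⟩ := Finset.mem_Icc.1 hm
  have hM : 1 ≤ M := hm1.trans hmM
  constructor
  · intro h
    have hmem := numRounds_mem (R₀ := R₀) (J := J) hM ω
    rw [h] at hmem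
    refine ⟨?_, hmem.2⟩
    rcases Nat.eq_or_lt_of_le hm1 with h1 | h1
    · rw [← h1]
      exact h0 ω
    · have hlt : m - 1 < sInf {m : ℕ | 1 ≤ m ∧ (R₀ ≤ J m ω ∨ m = M)} := by
        change sInf _ = m at h
        omega
      have := Nat.notMem_of_lt_sInf hlt
      by_contra hcon
      exact this ⟨by omega, Or.inl (not_lt.1 hcon)⟩
  · rintro ⟨h1, h2⟩
    refine le_antisymm (Nat.sInf_le ⟨hm1, h2⟩) ?_
    by_contra hlt
    obtain ⟨-, h3⟩ := numRounds_mem (R₀ := R₀) (J := J) hM ω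
    rw [not_le] at hlt
    rcases h3 with h3 | h3
    · have := hmono (j := numRounds M R₀ J ω) (m := m - 1) (by omega) (by omega) ω
      linarith
    · omega

end

theorem measureReal_numRounds_eq {Ω : Type*} [MeasurableSpace Ω] {P : Measure Ω}
    [IsProbabilityMeasure P] {M : ℕ} {R₀ : ℝ} {J : ℕ → Ω → ℝ} (h0 : ∀ ω, J 0 ω < R₀)
    (hmono : ∀ {j m : ℕ}, j ≤ m → m ≤ M → ∀ ω, J j ω ≤ J m ω)
    (hmeas : ∀ m ≤ M, Measurable (J m)) {m : ℕ} (hm : m ∈ Finset.Icc 1 (M - 1)) :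
    P.real {ω | numRounds M R₀ J ω = m} =
      P.real {ω | J (m - 1) ω < R₀} - P.real {ω | J m ω < R₀} := by
  obtain ⟨hm1, hmM⟩ := Finset.mem_Icc.1 hm
  have hsub : {ω | J m ω < R₀} ⊆ {ω | J (m - 1) ω < R₀} := fun ω hω =>
    (hmono (Nat.sub_le m 1) (by omega) ω).trans_lt hω
  rw [← measureReal_sdiff hsub (measurableSet_lt (hmeas m (by omega)) measurable_const)]
  congr 1
  ext ω
  have := numRounds_eq_iff h0 hmono (Finset.mem_Icc.2 ⟨hm1, by omega⟩ : m ∈ Finset.Icc 1 M) ω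
  simp only [Set.mem_ofPred_eq, Set.mem_sdiff, not_lt]
  rw [this]
  have hne : m ≠ M := by omega
  simp [hne]

theorem setOf_numRounds_eq_max {Ω : Type*} {M : ℕ} {R₀ : ℝ} {J : ℕ → Ω → ℝ} (hM : 1 ≤ M)
    (h0 : ∀ ω, J 0 ω < R₀) (hmono : ∀ {j m : ℕ}, j ≤ m → m ≤ M → ∀ ω, J j ω ≤ J m ω) :
    {ω | numRounds M R₀ J ω = M} = {ω | J (M - 1) ω < R₀} := by
  ext ω
  have := numRounds_eq_iff h0 hmono (Finset.mem_Icc.2 ⟨hM, le_rfl⟩ : M ∈ Finset.Icc 1 M) ω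
  simpa using this

/-- Law of total probability for an eavesdropper that is independent of the legitimate user. -/
theorem secrecyOutage_eq_sum {Ω : Type*} {mJ mK : MeasurableSpace Ω} [mΩ : MeasurableSpace Ω] {P : Measure Ω}
    [IsProbabilityMeasure P] {M : ℕ} {R₀ Rs : ℝ} {J K : ℕ → Ω → ℝ} (hM : 1 ≤ M)
    (h0 : ∀ ω, J 0 ω < R₀) (hmono : ∀ {j m : ℕ}, j ≤ m → m ≤ M → ∀ ω, J j ω ≤ J m ω)
    (hmJ : mJ ≤ mΩ) (hmK : mK ≤ mΩ) (hindep : Indep mJ mK P)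
    (hJ : ∀ m ≤ M, Measurable[mJ] (J m)) (hK : ∀ m ≤ M, Measurable[mK] (K m)) :
    secrecyOutage P M R₀ Rs J K = ∑ m ∈ Finset.Icc 1 M,
      P.real {ω | numRounds M R₀ J ω = m} * P.real {ω | R₀ - Rs < K m ω} := by
  have hNm : ∀ m ∈ Finset.Icc 1 M, MeasurableSet[mJ] {ω | numRounds M R₀ J ω = m} := by
    intro m hm
    have hmM := (Finset.mem_Icc.1 hm).2
    have : {ω | numRounds M R₀ J ω = m} =
        (J (m - 1) ⁻¹' Set.Iio R₀) ∩ ((J m ⁻¹' Set.Ici R₀) ∪ {_ω | m = M}) := by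
      ext ω
      exact numRounds_eq_iff h0 hmono hm ω
    rw [this]
    exact (hJ (m - 1) (by omega) measurableSet_Iio).inter
      ((hJ m hmM measurableSet_Ici).union (MeasurableSet.const _))
  have hKm : ∀ m ∈ Finset.Icc 1 M, MeasurableSet[mK] {ω | R₀ - Rs < K m ω} := fun m hm =>
    hK m (Finset.mem_Icc.1 hm).2 measurableSet_Ioi
  have hunion : {ω | R₀ - Rs < K (numRounds M R₀ J ω) ω} = ⋃ m ∈ Finset.Icc 1 M,
      ({ω | numRounds M R₀ J ω = m} ∩ {ω | R₀ - Rs < K m ω}) := by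
    ext ω
    simp only [Set.mem_ofPred_eq, Set.mem_iUnion, Set.mem_inter_iff, exists_prop]
    constructor
    · intro h
      exact ⟨_, numRounds_mem_Icc hM ω, rfl, h⟩
    · rintro ⟨m, -, h1, h2⟩
      rwa [h1]
  rw [secrecyOutage, hunion, measureReal_biUnion_finset]
  · refine Finset.sum_congr rfl fun m hm => ?_
    rw [measureReal_def, (Indep_iff _ _ _).1 hindep _ _ (hNm m hm) (hKm m hm), ENNReal.toReal_mul]
    rfl
  · intro i _ j _ hij
    refine Set.disjoint_left.2 fun ω hi hj => hij ?_
    exact hi.1.symm.trans hj.1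
  · exact fun m hm => (hmJ _ (hNm m hm)).inter (hmK _ (hKm m hm))

theorem mainTheorem1
    {Ω : Type*} [MeasurableSpace Ω] (P : Measure Ω) [IsProbabilityMeasure P]
    -- maximum number of rounds, rates, signal-to-noise ratios
    (M : ℕ) (hM : 1 ≤ M) (R₀ Rs : ℝ) (hR₀ : 0 < R₀) (hRs : Rs < R₀)
    (ρ : ℕ → ℝ) (hρ : ∀ m ∈ Finset.Icc 1 M, 0 < ρ m)
    -- channel parameters
    (α μ : ℝ) (hα : 0 < α) (hμ : 0 < μ)
    (φ S hf hl : Receiver → ℝ) (hφ : ∀ β, 0 < φ β) (hS : ∀ β, 0 < S β) (hhf : ∀ β, 0 < hf β)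
    (hhl : ∀ β, hl β ≠ 0)
    -- fading coefficients: independent over receivers and rounds, with the prescribed density
    (h : Receiver → ℕ → Ω → ℂ) (hmeas : ∀ β, ∀ m ∈ Finset.Icc 1 M, Measurable (h β m))
    (hindep : iIndepFun (fun (p : Receiver × Finset.Icc 1 M) ω => ‖h p.1 p.2 ω‖) P)
    (hlaw : ∀ β, ∀ m ∈ Finset.Icc 1 M, P.map (fun ω => ‖h β m ω‖) =
      (volume.restrict (Set.Ioi 0)).withDensity
        (fun x => ENNReal.ofReal (fadingPDF α μ (φ β) (S β) (hf β) x)))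
    -- accumulated mutual information and number of rounds
    (I : Receiver → ℕ → Ω → ℝ) (hI : I = fun β => mutualInfo ρ (hl β) (h β))
    (N : Ω → ℕ) (hN : N = numRounds M R₀ (I .bob))
    -- closed form, with any abscissa of integration
    (c : ℝ) (hc : c < 0)
    (Ψ : Receiver → ℕ → ℝ → ℂ) (hΨ : Ψ = fun β => psi α μ (φ β) (S β) (hf β) (hl β) ρ c) :
    -- `Ψ` is the CDF of the accumulated mutual information
    (∀ β, ∀ m ∈ Finset.Icc 1 M, (m = 1 → ∃ k : ℕ, μ = k) → ∀ x : ℝ, 0 < x →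
      (P.real {ω | I β m ω < x} : ℂ) = Ψ β m x) ∧
    -- connection outage probability
    ((M = 1 → ∃ k : ℕ, μ = k) → (connectionOutage P M R₀ (I .bob) : ℂ) = Ψ .bob M R₀) ∧
    -- pmf of the number of rounds
    ((2 ≤ M → P.real {ω | N ω = 1} = 1 - P.real {ω | I .bob 1 ω < R₀}) ∧
      (∀ m ∈ Finset.Icc 2 (M - 1), P.real {ω | N ω = m} =
        P.real {ω | I .bob (m - 1) ω < R₀} - P.real {ω | I .bob m ω < R₀}) ∧
      P.real {ω | N ω = M} = P.real {ω | I .bob (M - 1) ω < R₀}) ∧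
    -- law of total probability
    secrecyOutage P M R₀ Rs (I .bob) (I .eve) =
      ∑ m ∈ Finset.Icc 1 M, P.real {ω | N ω = m} * P.real {ω | R₀ - Rs < I .eve m ω} ∧
    -- secrecy outage probability through the CDFs, for every `μ > 0`
    secrecyOutage P M R₀ Rs (I .bob) (I .eve) =
      ∑ m ∈ Finset.Icc 1 (M - 1),
        (P.real {ω | I .bob (m - 1) ω < R₀} - P.real {ω | I .bob m ω < R₀}) *
          (1 - P.real {ω | I .eve m ω < R₀ - Rs}) +
      P.real {ω | I .bob (M - 1) ω < R₀} * (1 - P.real {ω | I .eve M ω < R₀ - Rs}) ∧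
    -- secrecy outage probability through the closed form
    ((∃ k : ℕ, μ = k) → (secrecyOutage P M R₀ Rs (I .bob) (I .eve) : ℂ) =
      ∑ m ∈ Finset.Icc 1 (M - 1),
        (Ψ .bob (m - 1) R₀ - Ψ .bob m R₀) * (1 - Ψ .eve m (R₀ - Rs)) +
      Ψ .bob (M - 1) R₀ * (1 - Ψ .eve M (R₀ - Rs))) := by
  have hnorm : ∀ β, ∀ m ∈ Finset.Icc 1 M, Measurable fun ω => ‖h β m ω‖ :=
    fun β m hm => (hmeas β m hm).norm
  have hsub : ∀ {m : ℕ}, m ≤ M → ∀ k ∈ Finset.Icc 1 m, k ∈ Finset.Icc 1 M := fun hm k hk =>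
    Finset.Icc_subset_Icc le_rfl hm hk
  have hlaw' : ∀ β, ∀ m ∈ Finset.Icc 1 M, P.map (fun ω => ‖h β m ω‖) =
      fadingLaw α μ (φ β) (S β) (hf β) := hlaw
  have hindepβ : ∀ β, ∀ m ≤ M, iIndepFun (fun (k : Finset.Icc 1 m) ω => ‖h β k ω‖) P := by
    intro β m hm
    refine hindep.precomp
      (g := fun k : Finset.Icc 1 m => ((β, ⟨k, hsub hm k k.2⟩) : Receiver × Finset.Icc 1 M)) ?_
    intro k k' hkk'
    exact Subtype.ext (congrArg (fun p : Receiver × Finset.Icc 1 M => (p.2 : ℕ)) hkk')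
  have hImeas : ∀ β, ∀ m ≤ M, Measurable (I β m) := fun β m hm => by
    rw [hI]
    exact measurable_mutualInfo fun k hk => hnorm β k (hsub hm k hk)
  have h0 : ∀ β ω, I β 0 ω = 0 := fun β ω => by rw [hI]; exact mutualInfo_zero _ _ _ ω
  have h0' : ∀ ω, I .bob 0 ω < R₀ := fun ω => by rwa [h0]
  have hmono : ∀ {j m : ℕ}, j ≤ m → m ≤ M → ∀ ω, I .bob j ω ≤ I .bob m ω :=
    fun hjm hm ω => by
      rw [hI]
      exact mutualInfo_mono hρ hjm hm ω
  have hcdf : ∀ β, ∀ m ∈ Finset.Icc 1 M, (m = 1 → ∃ k : ℕ, μ = k) → ∀ x : ℝ, 0 < x →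
      (P.real {ω | I β m ω < x} : ℂ) = Ψ β m x := by
    intro β m hm hint x hx
    obtain ⟨hm1, hmM⟩ := Finset.mem_Icc.1 hm
    rw [hI, hΨ]
    obtain ⟨n, rfl⟩ : ∃ n, m = n + 1 := ⟨m - 1, by omega⟩
    cases n with
    | zero =>
      simp only [zero_add, psi]
      rw [cdf_mutualInfo_one_eq_psiOne hα hμ (hφ β) (hS β) (hhf β) (hhl β) (hρ 1 hm)
        (hnorm β 1 hm) (hlaw' β 1 hm) (hint rfl) hx]
    | succ n =>
      exact cdf_mutualInfo_eq_psiContour hα hμ (hφ β) (hS β) (hhf β) (hhl β) (by omega)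
        (fun k hk => hρ k (hsub hmM k hk)) (fun k hk => hnorm β k (hsub hmM k hk))
        (hindepβ β _ hmM) (fun k hk => hlaw' β k (hsub hmM k hk)) hc x
  have hpmf : ∀ m ∈ Finset.Icc 1 (M - 1), P.real {ω | N ω = m} =
      P.real {ω | I .bob (m - 1) ω < R₀} - P.real {ω | I .bob m ω < R₀} := fun m hm => by
    rw [hN]
    exact measureReal_numRounds_eq h0' hmono (hImeas .bob) hm
  have hpmfM : P.real {ω | N ω = M} = P.real {ω | I .bob (M - 1) ω < R₀} := by
    rw [hN, setOf_numRounds_eq_max hM h0' hmono]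
  have hP0 : P.real {ω | I .bob 0 ω < R₀} = 1 := by
    have : {ω | I .bob 0 ω < R₀} = Set.univ := Set.eq_univ_of_forall h0'
    rw [this, probReal_univ]
  have htotal : secrecyOutage P M R₀ Rs (I .bob) (I .eve) =
      ∑ m ∈ Finset.Icc 1 M, P.real {ω | N ω = m} * P.real {ω | R₀ - Rs < I .eve m ω} := by
    rw [hN]
    have hI' := hindep.indep_iSup_comap (fun p => hnorm p.1 p.2 p.2.2)
      (S := {p | p.1 = Receiver.bob}) (T := {p | p.1 = Receiver.eve})
      (Set.disjoint_left.2 fun p hp hp' => by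
        rw [Set.mem_ofPred_eq] at hp hp'
        rw [hp] at hp'
        cases hp')
    have hle : ∀ T : Set (Receiver × Finset.Icc 1 M),
        (⨆ p ∈ T, MeasurableSpace.comap (fun ω => ‖h p.1 p.2 ω‖) inferInstance) ≤
        (inferInstance : MeasurableSpace Ω) := fun T =>
      iSup₂_le fun p _ => (hnorm p.1 p.2 p.2.2).comap_le
    have hmI : ∀ β, ∀ m ≤ M, Measurable[⨆ p ∈ {p : Receiver × Finset.Icc 1 M | p.1 = β},
        MeasurableSpace.comap (fun ω => ‖h p.1 p.2 ω‖) inferInstance] (I β m) := by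
      intro β m hm
      rw [hI]
      refine @measurable_mutualInfo Ω (_) ρ (hl β) (h β) m fun k hk => ?_
      exact measurable_iSup_comap (X := fun (p : Receiver × Finset.Icc 1 M) ω => ‖h p.1 p.2 ω‖)
        (i := (β, ⟨k, hsub hm k hk⟩)) rfl
    exact secrecyOutage_eq_sum hM h0' hmono (hle _) (hle _) hI' (hmI .bob) (hmI .eve)
  have heve : ∀ m ∈ Finset.Icc 1 M, P.real {ω | R₀ - Rs < I .eve m ω} =
      1 - P.real {ω | I .eve m ω < R₀ - Rs} := by
    intro m hm
    obtain ⟨hm1, hmM⟩ := Finset.mem_Icc.1 hm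
    have hnull : P {ω | I .eve m ω = R₀ - Rs} = 0 := by
      rw [hI]
      exact measure_mutualInfo_eq_zero (hhl .eve) hm1 (fun k hk => hρ k (hsub hmM k hk))
        (fun k hk => hnorm .eve k (hsub hmM k hk)) (hindepβ .eve m hmM)
        (fun k hk => hlaw' .eve k (hsub hmM k hk)) _
    rw [← probReal_compl_eq_one_sub (measurableSet_lt (hImeas .eve m hmM) measurable_const)]
    refine measureReal_congr ?_
    have hne : ∀ᵐ ω ∂P, I .eve m ω ≠ R₀ - Rs := by
      rw [ae_iff]
      simpa using hnull
    filter_upwards [hne] with ω hω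
    refine propext ?_
    change R₀ - Rs < I .eve m ω ↔ ¬ I .eve m ω < R₀ - Rs
    rw [not_lt]
    exact ⟨le_of_lt, fun hle => lt_of_le_of_ne hle hω.symm⟩
  have hM' : M ∈ Finset.Icc 1 M := Finset.mem_Icc.2 ⟨hM, le_rfl⟩
  have hle1 : ∀ m ∈ Finset.Icc 1 (M - 1), m ∈ Finset.Icc 1 M := hsub (Nat.sub_le M 1)
  have hcdfsum : secrecyOutage P M R₀ Rs (I .bob) (I .eve) =
      ∑ m ∈ Finset.Icc 1 (M - 1),
        (P.real {ω | I .bob (m - 1) ω < R₀} - P.real {ω | I .bob m ω < R₀}) *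
          (1 - P.real {ω | I .eve m ω < R₀ - Rs}) +
      P.real {ω | I .bob (M - 1) ω < R₀} * (1 - P.real {ω | I .eve M ω < R₀ - Rs}) := by
    rw [htotal, ← hpmfM, ← heve M hM']
    have hsplit : ∀ f : ℕ → ℝ, ∑ m ∈ Finset.Icc 1 M, f m =
        ∑ m ∈ Finset.Icc 1 (M - 1), f m + f M := by
      intro f
      obtain ⟨n, rfl⟩ : ∃ n, M = n + 1 := ⟨M - 1, by omega⟩
      rw [Finset.sum_Icc_succ_top (by omega), Nat.add_sub_cancel]
    rw [hsplit]
    congr 1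
    exact Finset.sum_congr rfl fun m hm => by rw [hpmf m hm, heve m (hle1 m hm)]
  refine ⟨hcdf, fun hint => hcdf .bob M hM' hint R₀ hR₀, ⟨fun h2 => ?_, fun m hm => ?_, hpmfM⟩,
    htotal, hcdfsum, fun hint => ?_⟩
  · rw [hpmf 1 (Finset.mem_Icc.2 ⟨le_rfl, by omega⟩), Nat.sub_self, hP0]
  · exact hpmf m (Finset.Icc_subset_Icc one_le_two le_rfl hm)
  · have hbob : ∀ m ≤ M, (P.real {ω | I .bob m ω < R₀} : ℂ) = Ψ .bob m R₀ := by
      intro m hm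
      rcases Nat.eq_zero_or_pos m with rfl | hm0
      · rw [hP0, hΨ]
        simp [psi]
      · exact hcdf .bob m (Finset.mem_Icc.2 ⟨hm0, hm⟩) (fun _ => hint) R₀ hR₀
    have heveΨ : ∀ m ∈ Finset.Icc 1 M, (P.real {ω | I .eve m ω < R₀ - Rs} : ℂ) =
        Ψ .eve m (R₀ - Rs) := fun m hm => hcdf .eve m hm (fun _ => hint) _ (by linarith)
    rw [hcdfsum]
    push_cast
    rw [hbob (M - 1) (Nat.sub_le M 1), heveΨ M hM']
    congr 1
    refine Finset.sum_congr rfl fun m hm => ?_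
    have hmM := (Finset.mem_Icc.1 (hle1 m hm)).2
    rw [hbob m hmM, hbob (m - 1) (by omega), heveΨ m (hle1 m hm)]
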